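/- A \emph{cube complex} $X$ is a quotient of a disjoint union of Euclidean cubes $[-1/2,1/2]^{n_i}$ ($i\in I$) such that the quotient map is injective on the relative interior of every face of every cube, and whenever two points $x,y$ of cubes are identified, there is an isometry from the smallest face containing $x$ onto the smallest face containing $y$ that identifies each point with its image. Its cells are the images of the faces of the cubes, its dimension is $\sup_i n_i$, and $d$ is its intrinsic metric: $d(x,y)$ is the infimum of $\sum_k d_k(x_{k-1},x_k)$ over all finite sequences $x=x_0,\dots,x_m=y$ in which $x_{k-1},x_k$ are points of a common cube, $d_k$ being the Euclidean distance in that cube. $X$ is \emph{CAT(0)} if $(X,d)$ is a geodesic metric space satisfying the CAT(0) inequality for geodesic triangles. For vertices $u,v$ let $D(u,v)$ be the least number of edges in an edge path from $u$ to $v$ in the $1$-skeleton of $X$. \textbf{Technical Lemma.} Let $X$ be a CAT(0) cube complex. Then any two vertices of $X$ are joined by an edge path, and the following hold. \begin{enumerate} \item $D$ is a conditionally negative kernel on the vertex set of $X$: for all vertices $v_1,\dots,v_m$ and all real numbers $\lambda_1,\dots,\lambda_m$ with $\sum_i\lambda_i=0$ we have $\sum_{i,j}\lambda_i\lambda_j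 D(v_i,v_j)\le 0$. \item If a group $G$ acts cellularly on $X$ (each element of $G$ maps each $k$-cell onto a $k$-cell, for all $k$), then $D(gu,gv)=D(u,v)$ for all $g\in G$ and all vertices $u,v$. \item For all vertices $u,v$ we have $d(u,v)\le D(u,v)$; and if $X$ has finite dimension $n$, then $D(u,v)\le\sqrt n\,d(u,v)$. \end{enumerate} -/

import Mathlib

open scoped ENNReal NNReal

universe u v

/-- A conditionally negative kernel on a set `V`. -/
def IsConditionallyNegativeKernel {V : Type u} (f : V → V → ℝ) : Prop :=
  ∀ (s : Finset V) (c : V → ℝ), ∑ x ∈ s, c x = 0 →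
    ∑ x ∈ s, ∑ y ∈ s, c x * c y * f x y ≤ 0

/-- `γ`, restricted to `[0, 1]`, is a geodesic from `x` to `y`, parametrized proportionally to
arc length. -/
def IsGeodesic {M : Type u} [PseudoEMetricSpace M] (γ : ℝ → M) (x y : M) : Prop :=
  γ 0 = x ∧ γ 1 = y ∧
    ∀ s ∈ Set.Icc (0 : ℝ) 1, ∀ t ∈ Set.Icc (0 : ℝ) 1,
      edist (γ s) (γ t) = ENNReal.ofReal |s - t| * edist x y

/-- `M` is a CAT(0) space: its distance is a finite metric, any two points are joined by a
geodesic, and geodesic triangles are no wider than their comparison triangles in the Euclidean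
plane. Any two sides of a triangle have a common vertex, here called `p`. -/
structure IsCAT0 (M : Type u) [PseudoEMetricSpace M] : Prop where
  edist_ne_top : ∀ x y : M, edist x y ≠ ∞
  eq_of_edist_eq_zero : ∀ x y : M, edist x y = 0 → x = y
  exists_geodesic : ∀ x y : M, ∃ γ : ℝ → M, IsGeodesic γ x y
  comparison : ∀ (p q r : M) (α β : ℝ → M), IsGeodesic α p q → IsGeodesic β p r →
    ∀ p' q' r' : EuclideanSpace ℝ (Fin 2),
      edist p' q' = edist p q → edist p' r' = edist p r → edist q' r' = edist q r →
      ∀ s ∈ Set.Icc (0 : ℝ) 1, ∀ t ∈ Set.Icc (0 : ℝ) 1,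
        edist (α s) (β t) ≤ edist (AffineMap.lineMap p' q' s) (AffineMap.lineMap p' r' t)

/-- The Euclidean cube `[-1/2, 1/2]^n`, with the Euclidean metric. -/
abbrev Cube (n : ℕ) : Type :=
  {x : EuclideanSpace ℝ (Fin n) // ∀ i, x i ∈ Set.Icc (-(1 / 2) : ℝ) (1 / 2)}

namespace Cube

/-- The coordinates of `x` that are not `± 1/2`: the directions of the smallest face
containing `x`. -/
noncomputable def freeCoords {n : ℕ} (x : Cube n) : Finset (Fin n) :=
  {i | |x.1 i| ≠ 1 / 2}

/-- The support of `x`: the smallest closed face of the cube containing `x`. Every nonempty face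
of the cube is the support of some point (of its centre, for example), and the relative interior
of a face is the set of the points whose support it is. -/
def support {n : ℕ} (x : Cube n) : Set (Cube n) :=
  {y | ∀ i, i ∉ x.freeCoords → y.1 i = x.1 i}

end Cube

/-- A cube complex: a quotient of a disjoint union of Euclidean cubes, in which the quotient map is
injective on the relative interior of each face of each cube and in which identified points have
their supports identified by an isometry. -/
structure CubeComplex where
  /-- the index set of the cubes -/
  Index : Type u
  /-- the dimensions of the cubes -/
  dim : Index → ℕ
  /-- the identifications -/
  glue : Setoid (Σ i : Index, Cube (dim i))
  injOn_interior : ∀ (i : Index) (x y : Cube (dim i)),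
    x.support = y.support → glue ⟨i, x⟩ ⟨i, y⟩ → x = y
  glue_support : ∀ (i j : Index) (x : Cube (dim i)) (y : Cube (dim j)),
    glue ⟨i, x⟩ ⟨j, y⟩ →
      ∃ h : x.support ≃ᵢ y.support, ∀ z : x.support, glue ⟨i, z.1⟩ ⟨j, (h z).1⟩

namespace CubeComplex

variable (X : CubeComplex.{u})

/-- The points of the cube complex. -/
def Point : Type u := Quotient X.glue

/-- The characteristic map of the `i`-th cube. -/
def proj (i : X.Index) (x : Cube (X.dim i)) : X.Point := Quotient.mk X.glue ⟨i, x⟩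

/-- There is a string of length `ℓ` from `x` to `y`: a finite sequence of points from `x` to `y` in
which each two consecutive points are given as points of a common cube, the length being the sum
of their distances in these cubes. -/
inductive HasString : X.Point → X.Point → ℝ≥0 → Prop
  | nil (x : X.Point) : HasString x x 0
  | cons (i : X.Index) (a b : Cube (X.dim i)) (y : X.Point) (ℓ : ℝ≥0) :
      HasString (X.proj i b) y ℓ → HasString (X.proj i a) y (nndist a b + ℓ)

variable {X}

theorem HasString.trans {x y z : X.Point} {ℓ m : ℝ≥0} (h : X.HasString x y ℓ)
    (h' : X.HasString y z m) : X.HasString x z (ℓ + m) := by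
  induction h with
  | nil x => simpa using h'
  | cons i a b y ℓ _ ih =>
    rw [add_assoc]
    exact .cons i a b z _ (ih h')

theorem HasString.symm {x y : X.Point} {ℓ : ℝ≥0} (h : X.HasString x y ℓ) :
    X.HasString y x ℓ := by
  induction h with
  | nil x => exact .nil x
  | cons i a b y ℓ _ ih =>
    have h1 := HasString.cons i b a _ 0 (.nil (X.proj i a))
    rw [add_zero, nndist_comm] at h1
    rw [add_comm]
    exact ih.trans h1

/-- The intrinsic distance of the cube complex: the infimum of the lengths of strings. -/
noncomputable instance : PseudoEMetricSpace X.Point where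
  edist x y := ⨅ (ℓ : ℝ≥0) (_ : X.HasString x y ℓ), (ℓ : ℝ≥0∞)
  edist_self x := le_antisymm (iInf₂_le_of_le 0 (.nil x) (by simp)) zero_le
  edist_comm x y := le_antisymm
    (le_iInf₂ fun ℓ h => iInf₂_le ℓ h.symm) (le_iInf₂ fun ℓ h => iInf₂_le ℓ h.symm)
  edist_triangle x y z := by
    refine ENNReal.le_iInf₂_add_iInf₂ fun ℓ h m h' => ?_
    exact iInf₂_le_of_le (ℓ + m) (h.trans h') (by simp)

variable (X)

/-- The metric `d` of the cube complex as a real number. -/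
noncomputable def d (x y : X.Point) : ℝ := (edist x y).toReal

/-- The dimension of the cube complex (possibly infinite). -/
noncomputable def dimension : ℕ∞ := ⨆ i, (X.dim i : ℕ∞)

/-- `S` is a closed `k`-dimensional cell of `X`: the image of a `k`-dimensional closed face of one
of the cubes. -/
def IsCell (k : ℕ) (S : Set X.Point) : Prop :=
  ∃ (i : X.Index) (a : Cube (X.dim i)), a.freeCoords.card = k ∧ S = X.proj i '' a.support

/-- The vertices of `X`: the `0`-dimensional cells. -/
def Vertex : Type u := {x : X.Point // X.IsCell 0 {x}}

/-- The graph underlying the `1`-skeleton of `X`: two different vertices are adjacent if they are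
the ends of an edge, i.e. lie in a common `1`-dimensional cell. -/
def oneSkeleton : SimpleGraph X.Vertex where
  Adj u v := u ≠ v ∧ ∃ e : Set X.Point, X.IsCell 1 e ∧ u.1 ∈ e ∧ v.1 ∈ e
  symm := ⟨fun _ _ ⟨h, e, he, hu, hv⟩ => ⟨h.symm, e, he, hv, hu⟩⟩
  loopless := ⟨fun _ h => h.1 rfl⟩

/-- The edge-path metric `D` on the vertices: the length of a shortest edge path. -/
noncomputable def D (x y : X.Vertex) : ℝ := X.oneSkeleton.dist x y

/-- The group `G` acts cellularly on `X`: each element maps each `k`-cell onto a `k`-cell. -/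
def IsCellularAction (G : Type v) [Group G] [MulAction G X.Point] : Prop :=
  ∀ (g : G) (k : ℕ) (S : Set X.Point), X.IsCell k S → X.IsCell k ((fun x => g • x) '' S)

variable {X}

/-- The image `g v` of a vertex `v` under a cellular action. -/
def IsCellularAction.vertexMap {G : Type v} [Group G] [MulAction G X.Point]
    (h : X.IsCellularAction G) (g : G) (x : X.Vertex) : X.Vertex :=
  ⟨g • x.1, by simpa using h g 0 {x.1} x.2⟩

end CubeComplex

/-!
A hyperplane is a class of parallel coordinate directions of the cubes, and `D x y` is the number of
hyperplanes that separate `x` from `y`; this is a sum of the kernels `(χ x - χ y) ^ 2` for the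
indicators `χ` of the sides, hence conditionally negative.

The sides of a hyperplane come from the CAT(0) inequality, which makes the distance to a point `v`
midpoint convex along short coordinate segments, so that an interior local maximum of it is also a
local minimum. A local minimum propagates along the geodesic to `v`: near each of its points the
geodesic lifts to a cube, where the coordinate in question stays constant. So if the distance to `v`
has an interior local extremum in a direction dual to the hyperplane, then `v` lies in a cell having
such a direction. For all other `v`, and in particular for vertices, the distance to `v` is strictly
monotone along each segment dual to the hyperplane, and the sense in which it is increasing, which
tells the side of `v`, does not depend on the segment.

An edge crosses exactly the hyperplane dual to it. If `x ≠ y`, the first piece of the geodesic from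
`x` to `y` lies in a cube, and an edge at `x` along which the distance to `y` decreases at first is
dual to a hyperplane that separates `x` from `y`; so `x` has a neighbour with one separating
hyperplane less.

For `D ≤ √n d`, a string is replaced by an edge path that runs through corners of the cubes it
visits. Its length is governed by the `ℓ¹` distance in the cubes, which is preserved by the gluing
isometries and is at most `√n` times the Euclidean distance.
-/

section Kernel

open scoped symmDiff

variable {V : Type u} {W : Type v}

theorem isConditionallyNegativeKernel_sub_sq (χ : V → ℝ) :
    IsConditionallyNegativeKernel fun x y => (χ x - χ y) ^ 2 := fun s c hc => by
  have expand : ∀ x y, c x * c y * (χ x - χ y) ^ 2 =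
      c x * χ x ^ 2 * c y + c x * (c y * χ y ^ 2) - 2 * (c x * χ x * (c y * χ y)) :=
    fun x y => by ring
  simp only [expand, Finset.sum_sub_distrib, Finset.sum_add_distrib, ← Finset.mul_sum,
    ← Finset.sum_mul, hc]
  nlinarith [mul_self_nonneg (∑ x ∈ s, c x * χ x)]

theorem isConditionallyNegativeKernel_ncard_symmDiff (φ : V → Set W)
    (hφ : ∀ x y, (φ x ∆ φ y).Finite) :
    IsConditionallyNegativeKernel fun x y => ((φ x ∆ φ y).ncard : ℝ) := fun s c hc => by
  classical
  let B : Finset W := s.biUnion fun x => s.biUnion fun y => (hφ x y).toFinset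
  let χ (w : W) (x : V) : ℝ := if w ∈ φ x then 1 else 0
  have ncard_eq_sum : ∀ x ∈ s, ∀ y ∈ s,
      ((φ x ∆ φ y).ncard : ℝ) = ∑ w ∈ B, (χ w x - χ w y) ^ 2 := fun x hx y hy => by
    have hB : (hφ x y).toFinset ⊆ B :=
      (Finset.subset_biUnion_of_mem (fun y => (hφ x y).toFinset) hy).trans
        (Finset.subset_biUnion_of_mem (fun x => s.biUnion fun y => (hφ x y).toFinset) hx)
    have indicator : ∀ w, (χ w x - χ w y) ^ 2 = if w ∈ (hφ x y).toFinset then 1 else 0 :=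
      fun w => by
        by_cases hwx : w ∈ φ x <;> by_cases hwy : w ∈ φ y <;>
          simp [χ, Set.mem_symmDiff, hwx, hwy]
    simp only [indicator, Finset.sum_ite_mem, Finset.inter_eq_right.2 hB, Finset.sum_const,
      nsmul_eq_mul, mul_one, Set.ncard_eq_toFinset_card _ (hφ x y)]
  calc ∑ x ∈ s, ∑ y ∈ s, c x * c y * ((φ x ∆ φ y).ncard : ℝ)
      = ∑ x ∈ s, ∑ y ∈ s, ∑ w ∈ B, c x * c y * (χ w x - χ w y) ^ 2 :=
        Finset.sum_congr rfl fun x hx => Finset.sum_congr rfl fun y hy => by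
          rw [ncard_eq_sum x hx y hy, Finset.mul_sum]
    _ = ∑ w ∈ B, ∑ x ∈ s, ∑ y ∈ s, c x * c y * (χ w x - χ w y) ^ 2 := by
        simp only [Finset.sum_comm (s := s) (t := B)]
    _ ≤ 0 := Finset.sum_nonpos fun w _ => isConditionallyNegativeKernel_sub_sq (χ w) s c hc

end Kernel

section Graph

open scoped symmDiff

variable {V : Type u} {W : Type v} {G : SimpleGraph V} {φ : V → Set W}

theorem finite_symmDiff_and_ncard_le_length_of_walk
    (hadj : ∀ x y, G.Adj x y → ∃ w, φ x ∆ φ y = {w}) {x y : V} (p : G.Walk x y) :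
    (φ x ∆ φ y).Finite ∧ (φ x ∆ φ y).ncard ≤ p.length := by
  induction p with
  | nil => simp
  | @cons x x' y h p ih =>
    obtain ⟨w, hw⟩ := hadj x x' h
    have hsub : φ x ∆ φ y ⊆ insert w (φ x' ∆ φ y) := by
      rw [← Set.singleton_union, ← hw]
      exact symmDiff_triangle (φ x) (φ x') (φ y)
    refine ⟨(ih.1.insert w).subset hsub, (Set.ncard_le_ncard hsub (ih.1.insert w)).trans ?_⟩
    exact (Set.ncard_insert_le _ _).trans (Nat.succ_le_succ ih.2)

theorem exists_walk_length_eq_ncard_symmDiff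
    (hadj : ∀ x y, G.Adj x y → ∃ w, φ x ∆ φ y = {w})
    (hsep : ∀ x y, x ≠ y → ∃ x', G.Adj x x' ∧ φ x ∆ φ x' ⊆ φ x ∆ φ y) {x y : V}
    (hfin : (φ x ∆ φ y).Finite) : ∃ p : G.Walk x y, p.length = (φ x ∆ φ y).ncard := by
  induction hn : (φ x ∆ φ y).ncard generalizing x with
  | zero =>
    rcases eq_or_ne x y with rfl | hxy
    · exact ⟨.nil, rfl⟩
    obtain ⟨x', hxx', hsub⟩ := hsep x y hxy
    obtain ⟨w, hw⟩ := hadj x x' hxx'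
    rw [Set.ncard_eq_zero hfin] at hn
    simp [hw, hn] at hsub
  | succ n ih =>
    have hxy : x ≠ y := by
      rintro rfl
      simp at hn
    obtain ⟨x', hxx', hsub⟩ := hsep x y hxy
    obtain ⟨w, hw⟩ := hadj x x' hxx'
    rw [hw, Set.singleton_subset_iff] at hsub
    have hdiff : φ x' ∆ φ y = (φ x ∆ φ y) \ {w} := by
      rw [← symmDiff_of_ge (Set.singleton_subset_iff.2 hsub), ← hw, symmDiff_symmDiff_symmDiff_comm,
        symmDiff_self, bot_symmDiff, symmDiff_comm]
    have hcard := Set.ncard_sdiff_singleton_add_one hsub hfin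
    obtain ⟨p, hp⟩ := ih (x := x') (hdiff ▸ hfin.subset Set.sdiff_subset) (by rw [hdiff]; lia)
    exact ⟨.cons hxx' p, by simp [hp]⟩

theorem dist_eq_ncard_symmDiff (hG : G.Preconnected)
    (hadj : ∀ x y, G.Adj x y → ∃ w, φ x ∆ φ y = {w})
    (hsep : ∀ x y, x ≠ y → ∃ x', G.Adj x x' ∧ φ x ∆ φ x' ⊆ φ x ∆ φ y) (x y : V) :
    G.dist x y = (φ x ∆ φ y).ncard := by
  obtain ⟨p, hp⟩ := (hG x y).exists_walk_length_eq_dist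
  obtain ⟨hfin, hle⟩ := finite_symmDiff_and_ncard_le_length_of_walk hadj p
  obtain ⟨q, hq⟩ := exists_walk_length_eq_ncard_symmDiff hadj hsep hfin
  exact (hq ▸ SimpleGraph.dist_le q).antisymm (hp ▸ hle)

theorem dist_map_iso {H : SimpleGraph W} (e : G ≃g H) (x y : V) :
    H.dist (e x) (e y) = G.dist x y := by
  by_cases hxy : G.Reachable x y
  · obtain ⟨p, hp⟩ := hxy.exists_walk_length_eq_dist
    obtain ⟨q, hq⟩ := (hxy.map e.toHom).exists_walk_length_eq_dist
    have hle := SimpleGraph.dist_le (p.map e.toHom)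
    have hge := SimpleGraph.dist_le ((q.map e.symm.toHom).copy (by simp) (by simp) : G.Walk x y)
    simp only [SimpleGraph.Walk.length_map, SimpleGraph.Walk.length_copy, hp, hq] at hle hge
    exact hle.antisymm hge
  · rw [SimpleGraph.dist_eq_zero_of_not_reachable hxy,
      SimpleGraph.dist_eq_zero_of_not_reachable (e.reachable_iff.not.2 hxy)]

end Graph

section Metric

open Filter Topology Set

theorem icc_induction {α : Type u} [ConditionallyCompleteLinearOrder α] [TopologicalSpace α]
    [OrderTopology α] [DenselyOrdered α] {a b : α} (hab : a ≤ b) {p : α → Prop}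
    (hp : ∀ t ∈ Icc a b, ∀ᶠ s in 𝓝[Icc a b] t, (s ≤ t → p s → p t) ∧ (t ≤ s → p t → p s))
    (ha : p a) : p b := by
  let S : Set α := {t ∈ Icc a b | p t}
  have haS : a ∈ S := ⟨left_mem_Icc.2 hab, ha⟩
  have hS : IsLUB S (sSup S) := isLUB_csSup ⟨a, haS⟩ ⟨b, fun t ht => ht.1.2⟩
  have hc : sSup S ∈ Icc a b := ⟨hS.1 haS, hS.2 fun t ht => ht.1.2⟩
  have hpc : p (sSup S) := by
    have hnear := eventually_nhdsWithin_iff.1 (hp _ hc)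
    obtain ⟨s, hs, hstep⟩ := ((hS.frequently_mem ⟨a, haS⟩).and_eventually
      (nhdsWithin_le_nhds hnear)).exists
    exact (hstep hs.1).1 (hS.1 hs) hs.2
  rcases hc.2.eq_or_lt with hcb | hcb
  · exact hcb ▸ hpc
  have hright : ∀ᶠ s in 𝓝[>] sSup S, s ∈ S := by
    have hnear := eventually_nhdsWithin_iff.1 (hp _ hc)
    filter_upwards [Ioo_mem_nhdsGT hcb, nhdsWithin_le_nhds hnear] with s hs hstep
    have hs' : s ∈ Icc a b := ⟨hc.1.trans hs.1.le, hs.2.le⟩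
    exact ⟨hs', (hstep hs').2 hs.1.le hpc⟩
  have := nhdsGT_neBot_of_exists_gt ⟨b, hcb⟩
  obtain ⟨s, hs, hcs⟩ := (hright.and self_mem_nhdsWithin).exists
  exact absurd (hS.1 hs) (not_le.2 hcs)

theorem exists_comparison_triangle {E : Type u} [NormedAddCommGroup E] [NormedSpace ℝ E]
    (hE : 1 < Module.rank ℝ E) {a b c : ℝ} (ha : 0 ≤ a) (hc : 0 ≤ c) (hac : |a - c| ≤ b)
    (hb : b ≤ a + c) : ∃ p q r : E, dist p q = c ∧ dist p r = a ∧ dist q r = b := by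
  have : Nontrivial E := rank_pos_iff_nontrivial.1 (zero_lt_one.trans hE)
  obtain ⟨e, he⟩ := exists_norm_eq E zero_le_one
  have hsphere : IsPreconnected (Metric.sphere (0 : E) a) := isPreconnected_sphere hE 0 a
  have hdist (s t : ℝ) : dist (s • e) (t • e) = |s - t| := by
    rw [dist_eq_norm, ← sub_smul, norm_smul, he, mul_one, Real.norm_eq_abs]
  obtain ⟨r, hr, hrb⟩ := hsphere.intermediate_value (f := fun r => dist (c • e) r)
    (a := a • e) (b := (-a) • e) (by simp [norm_smul, he, abs_of_nonneg ha])
    (by simp [norm_smul, he, abs_of_nonneg ha]) (by fun_prop)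
    (show b ∈ _ by
      simp only [hdist, sub_neg_eq_add]
      rw [abs_sub_comm, abs_of_nonneg (by linarith : 0 ≤ c + a), add_comm c a]
      exact ⟨hac, hb⟩)
  refine ⟨0, c • e, r, ?_, ?_, hrb⟩
  · simp [norm_smul, he, abs_of_nonneg hc]
  · rw [dist_comm]
    exact hr

theorem lt_iff_lt_of_isPreconnected {M : Type u} {β : Type v} [TopologicalSpace M] [LinearOrder β]
    [TopologicalSpace β] [OrderClosedTopology β] {S : Set M} (hS : IsPreconnected S) {f g : M → β}
    (hf : ContinuousOn f S) (hg : ContinuousOn g S) (hne : ∀ x ∈ S, f x ≠ g x) {x y : M}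
    (hx : x ∈ S) (hy : y ∈ S) : f x < g x ↔ f y < g y := by
  have lt_of_lt : ∀ {x y}, x ∈ S → y ∈ S → f x < g x → f y < g y := fun hx hy hlt => by
    by_contra! hle
    obtain ⟨z, hz, hfg⟩ := hS.intermediate_value₂ hx hy hf hg hlt.le hle
    exact hne z hz hfg
  exact ⟨lt_of_lt hx hy, lt_of_lt hy hx⟩

variable {M : Type u} [PseudoEMetricSpace M] {γ : ℝ → M} {x y : M}

theorem IsGeodesic.continuousOn (hγ : IsGeodesic γ x y) (hxy : edist x y ≠ ∞) :
    ContinuousOn γ (Icc 0 1) := by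
  have : LipschitzOnWith (edist x y).toNNReal γ (Icc 0 1) := fun s hs t ht => by
    rw [hγ.2.2 s hs t ht, ENNReal.coe_toNNReal hxy, edist_dist, Real.dist_eq, mul_comm]
  exact this.continuousOn

theorem IsGeodesic.edist_add_edist (hγ : IsGeodesic γ x y) {r s t : ℝ} (hr : 0 ≤ r) (hrs : r ≤ s)
    (hst : s ≤ t) (ht : t ≤ 1) : edist (γ r) (γ s) + edist (γ s) (γ t) = edist (γ r) (γ t) := by
  have hr' : r ∈ Icc (0 : ℝ) 1 := ⟨hr, by linarith⟩
  have hs' : s ∈ Icc (0 : ℝ) 1 := ⟨by linarith, by linarith⟩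
  have ht' : t ∈ Icc (0 : ℝ) 1 := ⟨by linarith, ht⟩
  rw [hγ.2.2 r hr' s hs', hγ.2.2 s hs' t ht', hγ.2.2 r hr' t ht', ← add_mul,
    ← ENNReal.ofReal_add (abs_nonneg _) (abs_nonneg _), abs_sub_comm r s, abs_sub_comm s t,
    abs_sub_comm r t, abs_of_nonneg (by linarith), abs_of_nonneg (by linarith),
    abs_of_nonneg (by linarith)]
  congr 2
  ring

theorem isGeodesic_of_edist_le (hfin : edist (γ 0) (γ 1) ≠ ∞)
    (hγ : ∀ s ∈ Icc (0 : ℝ) 1, ∀ t ∈ Icc (0 : ℝ) 1,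
      edist (γ s) (γ t) ≤ ENNReal.ofReal |s - t| * edist (γ 0) (γ 1)) :
    IsGeodesic γ (γ 0) (γ 1) := by
  have key : ∀ s ∈ Icc (0 : ℝ) 1, ∀ t ∈ Icc (0 : ℝ) 1, s ≤ t →
      edist (γ s) (γ t) = ENNReal.ofReal |s - t| * edist (γ 0) (γ 1) := by
    intro s hs t ht hst
    refine (hγ s hs t ht).antisymm ?_
    have h0 := hγ 0 (by simp) s hs
    have h1 := hγ t ht 1 (by simp)
    rw [zero_sub, abs_neg, abs_of_nonneg hs.1] at h0
    rw [abs_sub_comm, abs_of_nonneg (sub_nonneg.2 ht.2)] at h1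
    rw [abs_sub_comm, abs_of_nonneg (sub_nonneg.2 hst)]
    set e := edist (γ 0) (γ 1)
    have hends : ENNReal.ofReal s * e + ENNReal.ofReal (1 - t) * e ≠ ∞ := by finiteness
    refine ENNReal.le_of_add_le_add_right hends ?_
    calc ENNReal.ofReal (t - s) * e + (ENNReal.ofReal s * e + ENNReal.ofReal (1 - t) * e)
        = e := by
          rw [← add_mul, ← add_mul, ← ENNReal.ofReal_add hs.1 (sub_nonneg.2 ht.2),
            ← ENNReal.ofReal_add (sub_nonneg.2 hst) (by linarith [hs.1, ht.2]),
            show t - s + (s + (1 - t)) = 1 by ring, ENNReal.ofReal_one, one_mul]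
      _ ≤ edist (γ 0) (γ s) + edist (γ s) (γ t) + edist (γ t) (γ 1) := edist_triangle4 ..
      _ = edist (γ s) (γ t) + (edist (γ 0) (γ s) + edist (γ t) (γ 1)) := by ring
      _ ≤ _ := by gcongr
  refine ⟨rfl, rfl, fun s hs t ht => ?_⟩
  rcases le_total s t with hst | hts
  · exact key s hs t ht hst
  · rw [edist_comm, abs_sub_comm, key t ht s hs hts]

theorem IsCAT0.two_mul_edist_le (hM : IsCAT0 M) {p q : M} {α : ℝ → M} (hα : IsGeodesic α p q)
    (r : M) : 2 * edist (α (1 / 2)) r ≤ edist p r + edist q r := by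
  obtain ⟨β, hβ⟩ := hM.exists_geodesic p r
  obtain ⟨p', q', r', hpq, hpr, hqr⟩ : ∃ p' q' r' : EuclideanSpace ℝ (Fin 2),
      edist p' q' = edist p q ∧ edist p' r' = edist p r ∧ edist q' r' = edist q r := by
    let := PseudoEMetricSpace.toPseudoMetricSpace hM.edist_ne_top
    obtain ⟨p', q', r', hpq, hpr, hqr⟩ := exists_comparison_triangle
      (E := EuclideanSpace ℝ (Fin 2)) (by simp [← Module.finrank_eq_rank])
      (dist_nonneg (x := p) (y := r)) (dist_nonneg (x := p) (y := q)) (b := dist q r)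
      (by simpa only [dist_comm] using abs_dist_sub_le r q p)
      (by linarith [dist_triangle_left q r p])
    exact ⟨p', q', r', by simp only [edist_dist, hpq], by simp only [edist_dist, hpr],
      by simp only [edist_dist, hqr]⟩
  have hcomp := hM.comparison p q r α β hα hβ p' q' r' hpq hpr hqr (1 / 2) (by norm_num) 1
    (by norm_num)
  rw [hβ.2.1, AffineMap.lineMap_apply_one] at hcomp
  have hmid : 2 * dist (AffineMap.lineMap p' q' (1 / 2 : ℝ)) r' ≤ dist p' r' + dist q' r' := by
    have := dist_midpoint_midpoint_le p' q' r' r'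
    rw [midpoint_self, midpoint, invOf_eq_inv, ← one_div] at this
    linarith
  calc 2 * edist (α (1 / 2)) r
      ≤ 2 * edist (AffineMap.lineMap p' q' (1 / 2 : ℝ)) r' := by gcongr
    _ ≤ edist p' r' + edist q' r' := by
        have := ENNReal.ofReal_le_ofReal hmid
        rwa [ENNReal.ofReal_mul zero_le_two, ENNReal.ofReal_ofNat,
          ENNReal.ofReal_add dist_nonneg dist_nonneg, ← edist_dist, ← edist_dist,
          ← edist_dist] at this
    _ = edist p r + edist q r := by rw [hpr, hqr]

end Metric

theorem exists_abs_eq_one_of_sum_sq_eq_one {ι : Type u} {s : Finset ι} {δ : ι → ℝ}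
    (hδ : ∑ l ∈ s, δ l ^ 2 = 1) (habs : ∀ l ∈ s, δ l ≠ 0 → |δ l| = 1) :
    ∃ l ∈ s, |δ l| = 1 ∧ ∀ i ∈ s, i ≠ l → δ i = 0 := by
  classical
  obtain ⟨l, hl, hl0⟩ := Finset.exists_ne_zero_of_sum_ne_zero (hδ.trans_ne one_ne_zero)
  have hl1 := habs l hl (pow_ne_zero_iff two_ne_zero |>.1 hl0)
  rw [← Finset.add_sum_erase _ _ hl, ← sq_abs, hl1, one_pow, add_eq_left,
    Finset.sum_eq_zero_iff_of_nonneg fun _ _ => sq_nonneg _] at hδ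
  exact ⟨l, hl, hl1, fun i hi hil =>
    pow_eq_zero_iff two_ne_zero |>.1 (hδ i (Finset.mem_erase.2 ⟨hil, hi⟩))⟩

namespace Cube

section Coordinates

variable {n : ℕ} {x y z w : Cube n} {i k : Fin n}

theorem mem_freeCoords : i ∈ x.freeCoords ↔ |x.1 i| ≠ 1 / 2 := by
  simp [freeCoords]

theorem notMem_freeCoords : i ∉ x.freeCoords ↔ |x.1 i| = 1 / 2 := by
  rw [mem_freeCoords, not_not]

theorem abs_apply_le (x : Cube n) (i : Fin n) : |x.1 i| ≤ 1 / 2 :=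
  abs_le.2 ⟨(x.2 i).1, (x.2 i).2⟩

theorem abs_apply_lt (hi : i ∈ x.freeCoords) : |x.1 i| < 1 / 2 :=
  (x.abs_apply_le i).lt_of_ne (mem_freeCoords.1 hi)

theorem ext_apply (h : ∀ i, x.1 i = y.1 i) : x = y :=
  Subtype.ext (PiLp.ext h)

theorem mem_support_self (x : Cube n) : x ∈ x.support := fun _ _ => rfl

theorem freeCoords_subset_of_mem_support (h : x ∈ y.support) : x.freeCoords ⊆ y.freeCoords :=
  fun i hi => by
    by_contra hiy
    rw [mem_freeCoords, h i hiy] at hi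
    exact hiy (mem_freeCoords.2 hi)

theorem support_eq_of_mem (h : x ∈ y.support) (hf : y.freeCoords ⊆ x.freeCoords) :
    x.support = y.support := by
  ext z
  refine forall_congr' fun i => ?_
  rw [(freeCoords_subset_of_mem_support h).antisymm hf]
  exact forall_congr' fun hi => by rw [h i hi]

theorem dist_sq (x y : Cube n) : dist x y ^ 2 = ∑ i, (x.1 i - y.1 i) ^ 2 := by
  rw [Subtype.dist_eq, EuclideanSpace.dist_eq, Real.sq_sqrt (by positivity)]
  simp [Real.dist_eq, sq_abs]

theorem abs_sub_le_dist (x y : Cube n) (i : Fin n) : |x.1 i - y.1 i| ≤ dist x y := by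
  rw [← Real.dist_eq, Subtype.dist_eq]
  exact PiLp.dist_apply_le x.1 y.1 i

theorem dist_sq_of_mem_support (hz : z ∈ x.support) (hw : w ∈ x.support) :
    dist z w ^ 2 = ∑ i ∈ x.freeCoords, (z.1 i - w.1 i) ^ 2 := by
  rw [dist_sq]
  refine (Finset.sum_subset (Finset.subset_univ _) fun i _ hi => ?_).symm
  rw [hz i hi, hw i hi, sub_self, zero_pow two_ne_zero]

instance preconnectedSpace : PreconnectedSpace (Cube n) := by
  refine Subtype.preconnectedSpace (Convex.isPreconnected ?_)
  intro x hx y hy a b ha hb hab i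
  exact convex_Icc _ _ (hx i) (hy i) ha hb hab

/-- The retraction of `ℝ` onto `[-1/2, 1/2]`. -/
noncomputable def clamp (s : ℝ) : ℝ := max (-(1 / 2)) (min (1 / 2) s)

theorem clamp_mem_Icc (s : ℝ) : clamp s ∈ Set.Icc (-(1 / 2) : ℝ) (1 / 2) :=
  ⟨le_max_left _ _, max_le (by norm_num) (min_le_left _ _)⟩

theorem clamp_of_abs_le {s : ℝ} (hs : |s| ≤ 1 / 2) : clamp s = s := by
  rw [clamp, min_eq_right (abs_le.1 hs).2, max_eq_right (abs_le.1 hs).1]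

theorem clamp_mul {τ : ℝ} (hτ : |τ| = 1) (s : ℝ) : clamp (τ * s) = τ * clamp s := by
  rcases eq_or_eq_neg_of_abs_eq hτ with rfl | rfl
  · simp only [one_mul]
  · simp only [clamp, neg_one_mul, ← max_neg_neg, ← min_neg_neg, neg_neg]
    rw [max_min_distrib_left, max_eq_right (by norm_num : -(1 / 2) ≤ (1 / 2 : ℝ))]

theorem lipschitzWith_clamp : LipschitzWith 1 clamp :=
  (LipschitzWith.id.const_min _).const_max _

/-- The point of the cube with the coordinates of `f`, each cut off at `± 1/2`. -/
noncomputable def ofFun (f : Fin n → ℝ) : Cube n :=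
  ⟨WithLp.toLp 2 fun i => clamp (f i), fun i => clamp_mem_Icc (f i)⟩

theorem ofFun_apply (f : Fin n → ℝ) (i : Fin n) : (ofFun f).1 i = clamp (f i) := rfl

theorem continuous_ofFun : Continuous (ofFun : (Fin n → ℝ) → Cube n) :=
  Continuous.subtype_mk ((PiLp.continuous_toLp 2 _).comp (continuous_pi fun i =>
    lipschitzWith_clamp.continuous.comp (continuous_apply i))) _

/-- The point `x` with its `k`-th coordinate changed to `s`, cut off at `± 1/2`. -/
noncomputable def update (x : Cube n) (k : Fin n) (s : ℝ) : Cube n :=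
  ofFun (Function.update x.1 k s)

theorem update_apply_self (x : Cube n) (k : Fin n) (s : ℝ) : (x.update k s).1 k = clamp s := by
  rw [update, ofFun_apply, Function.update_self]

theorem update_apply_self_of_abs_le {s : ℝ} (hs : |s| ≤ 1 / 2) (x : Cube n) (k : Fin n) :
    (x.update k s).1 k = s := by
  rw [update_apply_self, clamp_of_abs_le hs]

theorem update_apply_of_ne (h : i ≠ k) (x : Cube n) (s : ℝ) : (x.update k s).1 i = x.1 i := by
  rw [update, ofFun_apply, Function.update_of_ne h, clamp_of_abs_le (x.abs_apply_le i)]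

theorem update_eq_self (x : Cube n) (k : Fin n) : x.update k (x.1 k) = x :=
  ext_apply fun i => by
    rw [update, Function.update_eq_self, ofFun_apply, clamp_of_abs_le (x.abs_apply_le i)]

theorem update_update (x : Cube n) (k : Fin n) (s t : ℝ) :
    (x.update k s).update k t = x.update k t :=
  ext_apply fun i => by
    rcases eq_or_ne i k with rfl | hi
    · simp only [update_apply_self]
    · simp only [update_apply_of_ne hi]

theorem update_mem_support (hz : z ∈ x.support) (hk : k ∈ x.freeCoords) (s : ℝ) :
    z.update k s ∈ x.support := fun i hi => by
  rw [update_apply_of_ne (ne_of_mem_of_not_mem hk hi).symm, hz i hi]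

theorem continuous_update (k : Fin n) : Continuous fun p : Cube n × ℝ => p.1.update k p.2 :=
  continuous_ofFun.comp (.update (by fun_prop) k continuous_snd)

theorem dist_update_update {s t : ℝ} (hs : |s| ≤ 1 / 2) (ht : |t| ≤ 1 / 2) (x : Cube n)
    (k : Fin n) : dist (x.update k s) (x.update k t) = |s - t| := by
  rw [← abs_of_nonneg (dist_nonneg (x := x.update k s) (y := x.update k t)),
    ← sq_eq_sq_iff_abs_eq_abs, dist_sq,
    Finset.sum_eq_single_of_mem k (Finset.mem_univ k) fun i _ hi => by
      rw [update_apply_of_ne hi, update_apply_of_ne hi, sub_self, zero_pow two_ne_zero],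
    update_apply_self_of_abs_le hs, update_apply_self_of_abs_le ht]

theorem dist_update_self {s : ℝ} (hs : |s| ≤ 1 / 2) (x : Cube n) (k : Fin n) :
    dist (x.update k s) x = |s - x.1 k| := by
  simpa only [update_eq_self] using dist_update_update hs (x.abs_apply_le k) x k

theorem dist_update_le_dist (x y : Cube n) (k : Fin n) (s : ℝ) :
    dist (x.update k s) (y.update k s) ≤ dist x y := by
  refine le_of_sq_le_sq ?_ dist_nonneg
  rw [dist_sq, dist_sq]
  refine Finset.sum_le_sum fun i _ => ?_
  rcases eq_or_ne i k with rfl | hi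
  · rw [update_apply_self, update_apply_self, sub_self, zero_pow two_ne_zero]
    exact sq_nonneg _
  · rw [update_apply_of_ne hi, update_apply_of_ne hi]

theorem dist_update_lt {s : ℝ} (hs : |s| ≤ 1 / 2) (h : |s - y.1 k| < |x.1 k - y.1 k|) :
    dist (x.update k s) y < dist x y := by
  refine lt_of_pow_lt_pow_left₀ 2 dist_nonneg ?_
  rw [dist_sq, dist_sq]
  refine Finset.sum_lt_sum (fun i _ => ?_) ⟨k, Finset.mem_univ k, ?_⟩
  · rcases eq_or_ne i k with rfl | hi
    · rw [update_apply_self_of_abs_le hs]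
      exact (sq_lt_sq.2 h).le
    · rw [update_apply_of_ne hi]
  · rw [update_apply_self_of_abs_le hs]
    exact sq_lt_sq.2 h

end Coordinates

section Isometries

variable {n m : ℕ} {x a z w : Cube n} {y : Cube m} {i k : Fin n}

theorem sub_sq_le_one (z w : Cube n) (i : Fin n) : (z.1 i - w.1 i) ^ 2 ≤ 1 := by
  rw [sq_le_one_iff_abs_le_one]
  exact (abs_sub _ _).trans (by linarith [z.abs_apply_le i, w.abs_apply_le i])

theorem sub_sq_eq_one_iff : (z.1 i - w.1 i) ^ 2 = 1 ↔ |z.1 i| = 1 / 2 ∧ w.1 i = -z.1 i := by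
  have hz := abs_le.1 (z.abs_apply_le i)
  have hw := abs_le.1 (w.abs_apply_le i)
  rw [sq_eq_one_iff, abs_eq (by norm_num)]
  grind

theorem dist_sq_le_card_freeCoords (hz : z ∈ x.support) (hw : w ∈ x.support) :
    dist z w ^ 2 ≤ x.freeCoords.card := by
  rw [dist_sq_of_mem_support hz hw, Finset.card_eq_sum_ones, Nat.cast_sum, Nat.cast_one]
  exact Finset.sum_le_sum fun i _ => sub_sq_le_one z w i

theorem dist_sq_eq_card_freeCoords_iff (hz : z ∈ x.support) (hw : w ∈ x.support) :
    dist z w ^ 2 = x.freeCoords.card ↔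
      ∀ i ∈ x.freeCoords, |z.1 i| = 1 / 2 ∧ w.1 i = -z.1 i := by
  rw [dist_sq_of_mem_support hz hw, Finset.card_eq_sum_ones, Nat.cast_sum, Nat.cast_one,
    Finset.sum_eq_sum_iff_of_le fun i _ => sub_sq_le_one z w i]
  simp only [sub_sq_eq_one_iff]

/-- The point of the support of `x` whose free coordinates are those of `f`, cut off at
`± 1/2`. -/
noncomputable def mkSupport (x : Cube n) (f : Fin n → ℝ) : x.support :=
  ⟨ofFun (x.freeCoords.piecewise f x.1), fun i hi => by
    rw [ofFun_apply, Finset.piecewise_eq_of_notMem _ _ _ hi, clamp_of_abs_le (x.abs_apply_le i)]⟩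

theorem mkSupport_apply {f : Fin n → ℝ} (hi : i ∈ x.freeCoords) (hf : |f i| ≤ 1 / 2) :
    (x.mkSupport f).1.1 i = f i := by
  rw [mkSupport, ofFun_apply, Finset.piecewise_eq_of_mem _ _ _ hi, clamp_of_abs_le hf]

theorem card_freeCoords_le (h : x.support ≃ᵢ y.support) :
    x.freeCoords.card ≤ y.freeCoords.card := by
  let c := x.mkSupport fun _ => 1 / 2
  let c' := x.mkSupport fun _ => -(1 / 2)
  have hcc' : dist c.1 c'.1 ^ 2 = x.freeCoords.card := by
    refine (dist_sq_eq_card_freeCoords_iff c.2 c'.2).2 fun i hi => ?_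
    rw [mkSupport_apply hi (by norm_num), mkSupport_apply hi (by norm_num)]
    norm_num
  have hle := dist_sq_le_card_freeCoords (h c).2 (h c').2
  rw [← Subtype.dist_eq, h.dist_eq, Subtype.dist_eq, hcc'] at hle
  exact_mod_cast hle

theorem card_freeCoords_eq (h : x.support ≃ᵢ y.support) :
    x.freeCoords.card = y.freeCoords.card :=
  (card_freeCoords_le h).antisymm (card_freeCoords_le h.symm)

theorem sum_mul_corner_eq (h : x.support ≃ᵢ y.support) {c : x.support}
    (hc : ∀ i ∈ x.freeCoords, |c.1.1 i| = 1 / 2) :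
    (∀ l ∈ y.freeCoords, |(h c).1.1 l| = 1 / 2) ∧ ∀ z : x.support,
      ∑ l ∈ y.freeCoords, (h z).1.1 l * (h c).1.1 l = ∑ i ∈ x.freeCoords, z.1.1 i * c.1.1 i := by
  have polarization : ∀ {n : ℕ} {x : Cube n} {z c a : x.support},
      (∀ i ∈ x.freeCoords, |c.1.1 i| = 1 / 2 ∧ a.1.1 i = -c.1.1 i) →
      dist z a ^ 2 - dist z c ^ 2 = 4 * ∑ i ∈ x.freeCoords, z.1.1 i * c.1.1 i := by
    intro n x z c a hca
    rw [Subtype.dist_eq z a, Subtype.dist_eq z c, dist_sq_of_mem_support z.2 a.2,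
      dist_sq_of_mem_support z.2 c.2, ← Finset.sum_sub_distrib, Finset.mul_sum]
    refine Finset.sum_congr rfl fun i hi => ?_
    rw [(hca i hi).2]
    ring
  let a := x.mkSupport fun i => -c.1.1 i
  have hca : ∀ i ∈ x.freeCoords, |c.1.1 i| = 1 / 2 ∧ a.1.1 i = -c.1.1 i := fun i hi =>
    ⟨hc i hi, mkSupport_apply hi (by rw [abs_neg]; exact c.1.abs_apply_le i)⟩
  have hhca : ∀ l ∈ y.freeCoords, |(h c).1.1 l| = 1 / 2 ∧ (h a).1.1 l = -(h c).1.1 l := by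
    rw [← dist_sq_eq_card_freeCoords_iff (h c).2 (h a).2, ← Subtype.dist_eq, h.dist_eq,
      ← card_freeCoords_eq h]
    exact (dist_sq_eq_card_freeCoords_iff c.2 a.2).2 hca
  refine ⟨fun l hl => (hhca l hl).1, fun z => ?_⟩
  have hz := polarization (z := h z) hhca
  rw [h.dist_eq, h.dist_eq, polarization hca] at hz
  linarith

theorem exists_apply_eq_sign_mul (h : x.support ≃ᵢ y.support) (hk : k ∈ x.freeCoords) :
    ∃ l ∈ y.freeCoords, ∃ τ : ℝ, |τ| = 1 ∧ ∀ z : x.support, (h z).1.1 l = τ * z.1.1 k := by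
  let c := x.mkSupport fun _ => 1 / 2
  let c' := x.mkSupport (Function.update (fun _ => 1 / 2) k (-(1 / 2)))
  have hc : ∀ i ∈ x.freeCoords, c.1.1 i = 1 / 2 := fun i hi => mkSupport_apply hi (by norm_num)
  have hck : c'.1.1 k = -(1 / 2) := by
    rw [mkSupport_apply hk] <;> simp [abs_of_pos]
  have hci : ∀ i ∈ x.freeCoords, i ≠ k → c'.1.1 i = 1 / 2 := fun i hi hik => by
    rw [mkSupport_apply hi] <;> simp [hik, abs_of_pos]
  obtain ⟨hhc, hcz⟩ := sum_mul_corner_eq h (c := c) fun i hi => by rw [hc i hi]; norm_num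
  obtain ⟨hhc', hcz'⟩ := sum_mul_corner_eq h (c := c') fun i hi => by
    rcases eq_or_ne i k with rfl | hik
    · rw [hck]; norm_num
    · rw [hci i hi hik]; norm_num
  let δ : Fin m → ℝ := fun l => (h c).1.1 l - (h c').1.1 l
  have hδz (z : x.support) : ∑ l ∈ y.freeCoords, (h z).1.1 l * δ l = z.1.1 k := by
    simp only [δ, mul_sub, Finset.sum_sub_distrib]
    rw [hcz z, hcz' z, ← Finset.sum_sub_distrib, Finset.sum_eq_single_of_mem k hk fun i hi hik => by
      rw [hc i hi, hci i hi hik, sub_self], hc k hk, hck]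
    ring
  have hδ : ∑ l ∈ y.freeCoords, δ l ^ 2 = 1 := by
    have hsq (l : Fin m) : δ l ^ 2 = (h c).1.1 l * δ l - (h c').1.1 l * δ l := by ring
    simp only [hsq, Finset.sum_sub_distrib]
    rw [hδz, hδz, hc k hk, hck]
    norm_num
  obtain ⟨l, hl, hτ, hoff⟩ := exists_abs_eq_one_of_sum_sq_eq_one hδ fun l hl hl0 => by
    rcases eq_or_eq_neg_of_abs_eq (hhc l hl) with h1 | h1 <;>
      rcases eq_or_eq_neg_of_abs_eq (hhc' l hl) with h2 | h2 <;>
      norm_num [δ, h1, h2] at hl0 <;> norm_num [δ, h1, h2]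
  refine ⟨l, hl, δ l, hτ, fun z => ?_⟩
  rw [← hδz z, Finset.sum_eq_single_of_mem l hl fun i hi hil => by rw [hoff i hi hil, mul_zero],
    mul_left_comm, ← sq, ← sq_abs, hτ]
  ring

theorem exists_signedPerm (h : x.support ≃ᵢ y.support) :
    ∃ (σ : x.freeCoords ≃ y.freeCoords) (τ : x.freeCoords → ℝ), (∀ k, |τ k| = 1) ∧
      ∀ (z : x.support) (k : x.freeCoords), (h z).1.1 (σ k) = τ k * z.1.1 k := by
  choose σ hσ τ hτ hστ using fun k : x.freeCoords => exists_apply_eq_sign_mul h k.2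
  have hinj : Function.Injective fun k => (⟨σ k, hσ k⟩ : y.freeCoords) := by
    intro k l hkl
    by_contra hne
    have hkl' : σ k = σ l := congrArg Subtype.val hkl
    let z := x.mkSupport (Pi.single k.1 (1 / 2))
    have hzk : z.1.1 k = 1 / 2 := by rw [mkSupport_apply k.2] <;> simp [abs_of_pos]
    have hzl : z.1.1 l = 0 := by
      rw [mkSupport_apply l.2] <;> simp [Subtype.coe_ne_coe.2 (Ne.symm hne)]
    have hz := hστ k z
    rw [hkl', hστ l z, hzk, hzl] at hz
    have := hτ k
    rw [show τ k = 0 by linarith] at this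
    simp at this
  have hbij := (Fintype.bijective_iff_injective_and_card _).2
    ⟨hinj, by simpa using card_freeCoords_eq h⟩
  exact ⟨.ofBijective _ hbij, τ, hτ, fun z k => hστ k z⟩

theorem freeCoords_map_self (h : x.support ≃ᵢ y.support) :
    (h ⟨x, x.mem_support_self⟩).1.freeCoords = y.freeCoords := by
  refine (freeCoords_subset_of_mem_support (h _).2).antisymm fun l hl => ?_
  obtain ⟨σ, τ, hτ, hστ⟩ := exists_signedPerm h
  obtain ⟨k, hk⟩ := σ.surjective ⟨l, hl⟩
  have hl' := congrArg (|·|) (hστ ⟨x, x.mem_support_self⟩ k)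
  rw [hk, abs_mul, hτ, one_mul] at hl'
  exact mem_freeCoords.2 (hl'.trans_ne (mem_freeCoords.1 k.2))

theorem exists_map_update_eq (h : x.support ≃ᵢ y.support) (hk : k ∈ x.freeCoords) :
    ∃ l ∈ y.freeCoords, ∃ τ : ℝ, |τ| = 1 ∧ (∀ z : x.support, (h z).1.1 l = τ * z.1.1 k) ∧
      ∀ (z : x.support) (s : ℝ),
        (h ⟨z.1.update k s, update_mem_support z.2 hk s⟩).1 = (h z).1.update l (τ * s) := by
  obtain ⟨σ, τ, hτ, hστ⟩ := exists_signedPerm h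
  refine ⟨σ ⟨k, hk⟩, (σ _).2, τ ⟨k, hk⟩, hτ _, fun z => hστ z ⟨k, hk⟩, fun z s => ?_⟩
  refine ext_apply fun l => ?_
  rcases eq_or_ne l (σ ⟨k, hk⟩).1 with rfl | hlk
  · rw [hστ, update_apply_self, update_apply_self, clamp_mul (hτ _)]
  rw [update_apply_of_ne hlk]
  by_cases hl : l ∈ y.freeCoords
  · obtain ⟨j, hj⟩ := σ.surjective ⟨l, hl⟩
    have hjk : j.1 ≠ k := by
      rintro rfl
      exact hlk (congrArg Subtype.val hj).symm
    obtain rfl : (σ j).1 = l := congrArg Subtype.val hj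
    rw [hστ, hστ, update_apply_of_ne hjk]
  · rw [(h _).2 l hl, (h _).2 l hl]

/-- The Euclidean distance of `x` to the faces of the cube that do not contain `x`, as far as it is
less than `1`. It only depends on `x` as a point of its support. -/
noncomputable def radius (x : Cube n) : ℝ≥0∞ :=
  x.freeCoords.inf (fun i => ENNReal.ofReal (1 / 2 - |x.1 i|)) ⊓ 1

theorem lt_radius_iff {e : ℝ≥0∞} :
    e < x.radius ↔ (∀ i ∈ x.freeCoords, e < ENNReal.ofReal (1 / 2 - |x.1 i|)) ∧ e < 1 := by
  rw [radius, lt_inf_iff]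
  refine and_congr_left fun he => ?_
  rw [Finset.lt_inf_iff (he.trans ENNReal.one_lt_top)]

theorem le_radius_iff {e : ℝ≥0∞} :
    e ≤ x.radius ↔ (∀ i ∈ x.freeCoords, e ≤ ENNReal.ofReal (1 / 2 - |x.1 i|)) ∧ e ≤ 1 := by
  rw [radius, le_inf_iff, Finset.le_inf_iff]

theorem radius_pos (x : Cube n) : 0 < x.radius :=
  lt_radius_iff.2 ⟨fun _ hi => ENNReal.ofReal_pos.2 (sub_pos.2 (abs_apply_lt hi)), one_pos⟩

theorem radius_map_self (h : x.support ≃ᵢ y.support) :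
    (h ⟨x, x.mem_support_self⟩).1.radius = x.radius := by
  obtain ⟨σ, τ, hτ, hστ⟩ := exists_signedPerm h
  have habs (k : x.freeCoords) : |(h ⟨x, x.mem_support_self⟩).1.1 (σ k)| = |x.1 k| := by
    rw [hστ, abs_mul, hτ, one_mul]
  refine eq_of_forall_le_iff fun e => ?_
  rw [le_radius_iff, le_radius_iff, freeCoords_map_self]
  refine and_congr_left fun _ => ?_
  constructor
  · intro hy k hk
    have := hy (σ ⟨k, hk⟩) (σ _).2
    rwa [habs] at this
  · intro hx l hl
    obtain ⟨k, hk⟩ := σ.surjective ⟨l, hl⟩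
    obtain rfl : (σ k).1 = l := congrArg Subtype.val hk
    rw [habs]
    exact hx k k.2

theorem freeCoords_subset_of_edist_lt (h : edist x a < x.radius) :
    x.freeCoords ⊆ a.freeCoords := fun i hi => by
  have hdist : dist x a < 1 / 2 - |x.1 i| := by
    have := (lt_radius_iff.1 h).1 i hi
    rwa [edist_lt_ofReal] at this
  refine mem_freeCoords.2 (ne_of_lt ?_)
  have := abs_sub_abs_le_abs_sub (a.1 i) (x.1 i)
  rw [abs_sub_comm] at this
  linarith [abs_sub_le_dist x a i]

theorem mem_support_of_edist_lt (h : edist x a < x.radius) : x ∈ a.support := fun i hi => by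
  have hdist : dist x a < 1 := by
    have := (lt_radius_iff.1 h).2
    rwa [← ENNReal.ofReal_one, edist_lt_ofReal] at this
  have ha := notMem_freeCoords.1 hi
  have hx := notMem_freeCoords.1 fun hx => hi (freeCoords_subset_of_edist_lt h hx)
  have := abs_lt.1 ((abs_sub_le_dist x a i).trans_lt hdist)
  rcases eq_or_eq_neg_of_abs_eq ha with ha | ha <;>
    rcases eq_or_eq_neg_of_abs_eq hx with hx | hx <;> linarith

theorem radius_le_add_edist (h : a.freeCoords ⊆ x.freeCoords) :
    x.radius ≤ a.radius + edist x a := by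
  rw [← tsub_le_iff_right, le_radius_iff]
  refine ⟨fun i hi => ?_, tsub_le_self.trans (le_radius_iff.1 le_rfl).2⟩
  rw [tsub_le_iff_right, edist_dist, ← ENNReal.ofReal_add (sub_nonneg.2 (a.abs_apply_le i))
    dist_nonneg]
  refine ((le_radius_iff.1 le_rfl).1 i (h hi)).trans (ENNReal.ofReal_le_ofReal ?_)
  have := abs_sub_abs_le_abs_sub (a.1 i) (x.1 i)
  rw [abs_sub_comm] at this
  linarith [abs_sub_le_dist x a i]

theorem freeCoords_update_subset (x : Cube n) (k : Fin n) (s : ℝ) :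
    (x.update k s).freeCoords ⊆ insert k x.freeCoords := fun i hi => by
  rcases eq_or_ne i k with rfl | hik
  · exact Finset.mem_insert_self ..
  · rw [mem_freeCoords, update_apply_of_ne hik, ← mem_freeCoords] at hi
    exact Finset.mem_insert_of_mem hi

/-- The distance of two points of a cube in the `ℓ¹` norm. For corners of the cube this is the
least number of edges of the cube that lead from the one to the other. -/
noncomputable def distOne (x y : Cube n) : ℝ := ∑ i, |x.1 i - y.1 i|

theorem distOne_triangle (x y z : Cube n) : x.distOne z ≤ x.distOne y + y.distOne z := by
  rw [distOne, distOne, distOne, ← Finset.sum_add_distrib]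
  exact Finset.sum_le_sum fun i _ => abs_sub_le _ _ _

theorem distOne_le (x y : Cube n) : x.distOne y ≤ √n * dist x y := by
  refine le_of_sq_le_sq ?_ (by positivity)
  have := sq_sum_le_card_mul_sum_sq (s := Finset.univ) (f := fun i => |x.1 i - y.1 i|)
  rw [mul_pow, Real.sq_sqrt (by positivity), dist_sq]
  simpa only [distOne, sq_abs, Finset.card_univ, Fintype.card_fin] using this

theorem distOne_map (h : x.support ≃ᵢ y.support) (z w : x.support) :
    (h z).1.distOne (h w).1 = z.1.distOne w.1 := by
  have sum_freeCoords : ∀ {n : ℕ} {x : Cube n} (z w : x.support),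
      z.1.distOne w.1 = ∑ i : x.freeCoords, |z.1.1 i - w.1.1 i| := fun {n x} z w => by
    rw [Finset.sum_coe_sort x.freeCoords fun i => |z.1.1 i - w.1.1 i|]
    refine (Finset.sum_subset (Finset.subset_univ _) fun i _ hi => ?_).symm
    rw [z.2 i hi, w.2 i hi, sub_self, abs_zero]
  obtain ⟨σ, τ, hτ, hστ⟩ := exists_signedPerm h
  rw [sum_freeCoords, sum_freeCoords, ← σ.sum_comp]
  refine Finset.sum_congr rfl fun k _ => ?_
  rw [hστ, hστ, ← mul_sub, abs_mul, hτ, one_mul]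

end Isometries

section Corners

variable {n : ℕ} {a b c c' : Cube n} {k l : Fin n}

/-- The corner that differs from the corner `c` in the `k`-th coordinate. -/
noncomputable def flip (c : Cube n) (k : Fin n) : Cube n := c.update k (-c.1 k)

theorem apply_eq_or_of_freeCoords_eq_empty (hc : c.freeCoords = ∅) (k : Fin n) :
    c.1 k = 1 / 2 ∨ c.1 k = -(1 / 2) := by
  have : k ∉ c.freeCoords := hc ▸ Finset.notMem_empty k
  exact (abs_eq (by norm_num)).1 (notMem_freeCoords.1 this)

theorem flip_apply_self (c : Cube n) (k : Fin n) : (c.flip k).1 k = -c.1 k :=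
  update_apply_self_of_abs_le (abs_neg (c.1 k) ▸ c.abs_apply_le k) c k

theorem flip_apply_of_ne (h : l ≠ k) (c : Cube n) : (c.flip k).1 l = c.1 l :=
  update_apply_of_ne h c _

theorem freeCoords_flip (hc : c.freeCoords = ∅) (k : Fin n) : (c.flip k).freeCoords = ∅ := by
  refine Finset.eq_empty_of_forall_notMem fun l => notMem_freeCoords.2 ?_
  rcases eq_or_ne l k with rfl | hlk
  · rw [flip_apply_self, abs_neg, notMem_freeCoords.1 (hc ▸ Finset.notMem_empty l)]
  · rw [flip_apply_of_ne hlk, notMem_freeCoords.1 (hc ▸ Finset.notMem_empty l)]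

theorem neg_apply_eq_of_ne (hc : c.freeCoords = ∅) (hc' : c'.freeCoords = ∅)
    (h : c.1 k ≠ c'.1 k) : -c.1 k = c'.1 k := by
  rcases apply_eq_or_of_freeCoords_eq_empty hc k with hk | hk <;>
    rcases apply_eq_or_of_freeCoords_eq_empty hc' k with hk' | hk' <;>
    simp_all

theorem flip_eq_of_forall_ne (hc : c.freeCoords = ∅) (hc' : c'.freeCoords = ∅) (hne : c ≠ c')
    (h : ∀ l ≠ k, c.1 l = c'.1 l) : c.flip k = c' := by
  have hk : c.1 k ≠ c'.1 k := fun hk => hne <| ext_apply fun l => by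
    rcases eq_or_ne l k with rfl | hlk
    exacts [hk, h l hlk]
  refine ext_apply fun l => ?_
  rcases eq_or_ne l k with rfl | hlk
  · rw [flip_apply_self, neg_apply_eq_of_ne hc hc' hk]
  · rw [flip_apply_of_ne hlk, h l hlk]

theorem abs_sub_neg_of_freeCoords_eq_empty (hc : c.freeCoords = ∅) (k : Fin n) :
    |c.1 k - -c.1 k| = 1 := by
  rcases apply_eq_or_of_freeCoords_eq_empty hc k with hk | hk <;> norm_num [hk]

theorem dist_flip (hc : c.freeCoords = ∅) (k : Fin n) : dist c (c.flip k) = 1 := by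
  rw [dist_comm, flip, dist_update_self (abs_neg (c.1 k) ▸ c.abs_apply_le k), abs_sub_comm,
    abs_sub_neg_of_freeCoords_eq_empty hc]

theorem distOne_flip (hc : c.freeCoords = ∅) (k : Fin n) : c.distOne (c.flip k) = 1 := by
  rw [distOne, Finset.sum_eq_single_of_mem k (Finset.mem_univ k) fun l _ hl => by
    rw [flip_apply_of_ne hl, sub_self, abs_zero], flip_apply_self,
    abs_sub_neg_of_freeCoords_eq_empty hc]

theorem distOne_add_distOne (h : ∀ k, b.1 k = a.1 k ∨ b.1 k = c.1 k) :
    a.distOne b + b.distOne c = a.distOne c := by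
  rw [distOne, distOne, distOne, ← Finset.sum_add_distrib]
  refine Finset.sum_congr rfl fun k _ => ?_
  rcases h k with hk | hk <;> rw [hk, sub_self, abs_zero]
  exacts [zero_add _, add_zero _]

theorem exists_corner_between (a : Cube n) (hc : c.freeCoords = ∅) :
    ∃ b : a.support, b.1.freeCoords = ∅ ∧ a.distOne b.1 + b.1.distOne c = a.distOne c := by
  have apply_eq {k : Fin n} (hk : k ∈ a.freeCoords) : (a.mkSupport c.1).1.1 k = c.1 k :=
    mkSupport_apply hk (c.abs_apply_le k)
  refine ⟨a.mkSupport c.1, Finset.eq_empty_of_forall_notMem fun k => notMem_freeCoords.2 ?_,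
    distOne_add_distOne fun k => ?_⟩
  all_goals by_cases hk : k ∈ a.freeCoords
  · rw [apply_eq hk, notMem_freeCoords.1 (hc ▸ Finset.notMem_empty k)]
  · rw [(a.mkSupport c.1).2 k hk, notMem_freeCoords.1 hk]
  · exact .inr (apply_eq hk)
  · exact .inl ((a.mkSupport c.1).2 k hk)

end Corners

end Cube

namespace CubeComplex

section Lifts

open Topology

variable {X : CubeComplex.{u}} {i j : X.Index} {x a : Cube (X.dim i)} {y : Cube (X.dim j)}

theorem exists_proj_eq (P : X.Point) : ∃ (i : X.Index) (x : Cube (X.dim i)), X.proj i x = P := by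
  obtain ⟨⟨i, x⟩, hx⟩ := Quotient.exists_rep P
  exact ⟨i, x, hx⟩

theorem exists_isometry_of_proj_eq (hxy : X.proj i x = X.proj j y) :
    ∃ h : x.support ≃ᵢ y.support, (h ⟨x, x.mem_support_self⟩).1 = y ∧
      ∀ z, X.proj i z.1 = X.proj j (h z).1 := by
  obtain ⟨h, hh⟩ := X.glue_support i j x y (Quotient.exact hxy)
  have hproj (z : x.support) : X.proj i z.1 = X.proj j (h z).1 := Quotient.sound (hh z)
  refine ⟨h, X.injOn_interior j _ _ ?_ (Quotient.exact ((hproj _).symm.trans hxy)), hproj⟩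
  exact Cube.support_eq_of_mem (h _).2 (Cube.freeCoords_map_self h).ge

theorem radius_eq_of_proj_eq (hxy : X.proj i x = X.proj j y) : x.radius = y.radius := by
  obtain ⟨h, hx, -⟩ := exists_isometry_of_proj_eq hxy
  rw [← Cube.radius_map_self h, hx]

theorem exists_proj_update_eq (hxy : X.proj i x = X.proj j y) {k : Fin (X.dim i)}
    (hk : k ∈ x.freeCoords) :
    ∃ l ∈ y.freeCoords, ∃ τ : ℝ, |τ| = 1 ∧ y.1 l = τ * x.1 k ∧
      ∀ s, X.proj i (x.update k s) = X.proj j (y.update l (τ * s)) := by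
  obtain ⟨h, hx, hproj⟩ := exists_isometry_of_proj_eq hxy
  obtain ⟨l, hl, τ, hτ, hmul, hupdate⟩ := Cube.exists_map_update_eq h hk
  refine ⟨l, hl, τ, hτ, ?_, fun s => ?_⟩
  · rw [← hmul ⟨x, x.mem_support_self⟩, hx]
  · rw [← hx, ← hupdate, ← hproj]

theorem eq_of_proj_eq (hxa : X.proj i x = X.proj i a) (h : edist x a < x.radius) : x = a := by
  refine X.injOn_interior i x a ?_ (Quotient.exact hxa)
  refine Cube.support_eq_of_mem (Cube.mem_support_of_edist_lt h) ?_
  rw [edist_comm, radius_eq_of_proj_eq hxa] at h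
  exact Cube.freeCoords_subset_of_edist_lt h

theorem edist_proj_le (i : X.Index) (a b : Cube (X.dim i)) :
    edist (X.proj i a) (X.proj i b) ≤ edist a b := by
  refine iInf₂_le_of_le (nndist a b + 0) (.cons i a b _ 0 (.nil _)) ?_
  rw [add_zero, edist_nndist]

theorem continuous_proj (i : X.Index) : Continuous (X.proj i) :=
  LipschitzWith.continuous (K := 1) fun a b => by
    rw [ENNReal.coe_one, one_mul]
    exact edist_proj_le i a b

theorem exists_lift_of_string {Q : X.Point} {ℓ : ℝ≥0} (h : X.HasString Q (X.proj i x) ℓ)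
    (hℓ : ℓ < x.radius) (hy : X.proj j y = Q) :
    ∃ z : Cube (X.dim j), X.proj j z = X.proj i x ∧ edist z y ≤ ℓ := by
  generalize hP : X.proj i x = P at h
  induction h generalizing j y with
  | nil Q => exact ⟨y, hy, by simp⟩
  | cons m a b P ℓ _ ih =>
    rw [ENNReal.coe_add, ← edist_nndist] at hℓ ⊢
    obtain ⟨z, hz, hzb⟩ := ih (le_add_self.trans_lt hℓ) rfl hP
    have hza : edist z a ≤ edist a b + ℓ := by
      rw [edist_comm a b, add_comm]
      exact (edist_triangle z b a).trans (by gcongr)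
    have hzs : z ∈ a.support :=
      Cube.mem_support_of_edist_lt (radius_eq_of_proj_eq (hP.trans hz.symm) ▸ hza.trans_lt hℓ)
    obtain ⟨h, ha, hproj⟩ := exists_isometry_of_proj_eq hy.symm
    refine ⟨(h ⟨z, hzs⟩).1, (hproj _).symm.trans hz, ?_⟩
    have hiso := h.edist_eq ⟨z, hzs⟩ ⟨a, a.mem_support_self⟩
    rw [Subtype.edist_eq, Subtype.edist_eq, ha] at hiso
    exact hiso.trans_le hza

theorem exists_lift (h : edist (X.proj i x) (X.proj j y) < x.radius / 2) :
    ∃ z : Cube (X.dim j), X.proj j z = X.proj i x ∧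
      edist z y = edist (X.proj i x) (X.proj j y) := by
  have lift_of_lt : ∀ e, edist (X.proj i x) (X.proj j y) < e → e ≤ x.radius / 2 →
      ∃ z : Cube (X.dim j), X.proj j z = X.proj i x ∧ edist z y < e := fun e he hr => by
    rw [edist_comm] at he
    obtain ⟨ℓ, hℓ⟩ := iInf_lt_iff.1 he
    obtain ⟨hℓ, hℓe⟩ := iInf_lt_iff.1 hℓ
    obtain ⟨z, hz, hzy⟩ := exists_lift_of_string hℓ
      (hℓe.trans_le (hr.trans ENNReal.half_le_self)) rfl
    exact ⟨z, hz, hzy.trans_lt hℓe⟩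
  obtain ⟨z, hz, hzy⟩ := lift_of_lt _ h le_rfl
  refine ⟨z, hz, (le_of_forall_gt fun e he => ?_).antisymm (hz ▸ edist_proj_le j z y)⟩
  obtain ⟨z', hz', hzy'⟩ := lift_of_lt (min e (x.radius / 2)) (lt_min he h) (min_le_right _ _)
  rw [lt_min_iff] at hzy'
  have hzz' : z = z' := by
    refine eq_of_proj_eq (hz.trans hz'.symm) ?_
    rw [radius_eq_of_proj_eq hz, ← ENNReal.add_halves x.radius]
    exact (edist_triangle_right z z' y).trans_lt (ENNReal.add_lt_add hzy hzy'.2)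
  exact hzz' ▸ hzy'.1

theorem edist_proj_eq (h : edist x a < x.radius / 2) :
    edist (X.proj i x) (X.proj i a) = edist x a := by
  obtain ⟨z, hz, hza⟩ := exists_lift ((edist_proj_le i x a).trans_lt h)
  have hxz : x = z := by
    refine eq_of_proj_eq hz.symm ?_
    rw [← ENNReal.add_halves x.radius]
    exact (edist_triangle_right x z a).trans_lt
      (ENNReal.add_lt_add h (hza ▸ (edist_proj_le i x a).trans_lt h))
  rw [← hza, hxz]

theorem eventually_exists_lift (P : X.Point) :
    ∀ᶠ Q in 𝓝 P, ∀ (j : X.Index) (y : Cube (X.dim j)), X.proj j y = Q →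
      ∃ z, X.proj j z = P ∧ edist z y = edist P Q := by
  obtain ⟨i, x, rfl⟩ := exists_proj_eq P
  filter_upwards [Metric.eball_mem_nhds (X.proj i x) (ENNReal.half_pos x.radius_pos.ne')]
    with Q hQ j y hy
  rw [Metric.mem_eball, edist_comm] at hQ
  subst hy
  exact exists_lift hQ

end Lifts

section Carriers

open Filter Topology Set

variable {X : CubeComplex.{u}} {i j : X.Index}

/-- Two coordinate directions of cubes are related if a segment in the one direction is glued to a
segment in the other, possibly with the opposite orientation. -/
def SharesSegment (X : CubeComplex.{u}) (e e' : Σ i : X.Index, Fin (X.dim i)) : Prop :=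
  ∃ (x : Cube (X.dim e.1)) (y : Cube (X.dim e'.1)) (τ : ℝ), |τ| = 1 ∧
    ∀ s, X.proj e.1 (x.update e.2 s) = X.proj e'.1 (y.update e'.2 (τ * s))

/-- The hyperplanes of `X`, each given as the class of the coordinate directions that are dual
to it. -/
def Hyperplane (X : CubeComplex.{u}) : Type u := Quot X.SharesSegment

/-- The hyperplane dual to the `k`-th coordinate direction of the `i`-th cube. -/
def hyperplane (i : X.Index) (k : Fin (X.dim i)) : X.Hyperplane := Quot.mk _ ⟨i, k⟩

/-- The open carrier of a hyperplane: the union of the relative interiors of the cells that have a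
direction dual to it. -/
def openCarrier (w : X.Hyperplane) : Set X.Point :=
  {P | ∃ (i : X.Index) (x : Cube (X.dim i)), X.proj i x = P ∧
    ∃ k ∈ x.freeCoords, hyperplane i k = w}

/-- The distance to `v` has a local minimum at `x` in the direction of the `k`-th coordinate. -/
def IsCoordMin (x : Cube (X.dim i)) (k : Fin (X.dim i)) (v : X.Point) : Prop :=
  IsLocalMin (fun s => edist (X.proj i (x.update k s)) v) (x.1 k)

/-- The points of the open carrier of `w` at which the distance to `v` has a local minimum in a
direction dual to `w`. -/
def minCarrier (w : X.Hyperplane) (v : X.Point) : Set X.Point :=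
  {P | ∃ (i : X.Index) (x : Cube (X.dim i)), X.proj i x = P ∧
    ∃ k ∈ x.freeCoords, hyperplane i k = w ∧ IsCoordMin x k v}

variable {y z : Cube (X.dim i)} {l : Fin (X.dim i)} {P v : X.Point} {w : X.Hyperplane}

theorem exists_hyperplane_eq_of_mem_openCarrier (h : P ∈ openCarrier w) {y : Cube (X.dim j)}
    (hy : X.proj j y = P) : ∃ l ∈ y.freeCoords, hyperplane j l = w := by
  obtain ⟨i, x, hx, k, hk, rfl⟩ := h
  obtain ⟨l, hl, τ, hτ, -, hupdate⟩ := exists_proj_update_eq (hx.trans hy.symm) hk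
  exact ⟨l, hl, (Quot.sound ⟨x, y, τ, hτ, hupdate⟩).symm⟩

theorem exists_isCoordMin_of_mem_minCarrier (h : P ∈ minCarrier w v) {y : Cube (X.dim j)}
    (hy : X.proj j y = P) : ∃ l ∈ y.freeCoords, hyperplane j l = w ∧ IsCoordMin y l v := by
  obtain ⟨i, x, hx, k, hk, rfl, hmin⟩ := h
  obtain ⟨l, hl, τ, hτ, hkl, hupdate⟩ := exists_proj_update_eq (hx.trans hy.symm) hk
  refine ⟨l, hl, (Quot.sound ⟨x, y, τ, hτ, hupdate⟩).symm, ?_⟩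
  have hττ (s : ℝ) : τ * (τ * s) = s := by
    rw [← mul_assoc, ← abs_mul_abs_self, hτ, one_mul, one_mul]
  have hcomp : (fun s => edist (X.proj j (y.update l s)) v) =
      (fun s => edist (X.proj i (x.update k s)) v) ∘ (τ * ·) := by
    ext s
    simp only [Function.comp_apply, hupdate, hττ]
  rw [IsCoordMin, hcomp]
  refine IsLocalMin.comp_continuous ?_ (continuous_const_mul τ).continuousAt
  rwa [hkl, hττ]

theorem edist_proj_update_lt (hv : edist (X.proj i z) v ≠ ∞)
    (hd : edist y z + edist (X.proj i z) v = edist (X.proj i y) v) {s : ℝ} (hs : |s| ≤ 1 / 2)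
    (h : |s - z.1 l| < |y.1 l - z.1 l|) :
    edist (X.proj i (y.update l s)) v < edist (X.proj i y) v :=
  calc edist (X.proj i (y.update l s)) v
      ≤ edist (X.proj i (y.update l s)) (X.proj i z) + edist (X.proj i z) v := edist_triangle ..
    _ ≤ edist (y.update l s) z + edist (X.proj i z) v := by gcongr; exact edist_proj_le ..
    _ < edist y z + edist (X.proj i z) v := by
        refine ENNReal.add_lt_add_right hv ?_
        rw [edist_dist y, edist_lt_ofReal]
        exact Cube.dist_update_lt hs h
    _ = edist (X.proj i y) v := hd

theorem IsCoordMin.apply_eq_of_edist_add_edist (h : IsCoordMin y l v)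
    (hv : edist (X.proj i z) v ≠ ∞)
    (hd : edist y z + edist (X.proj i z) v = edist (X.proj i y) v) : z.1 l = y.1 l := by
  by_contra hne
  have hline : Tendsto (AffineMap.lineMap (y.1 l) (z.1 l)) (𝓝[>] (0 : ℝ)) (𝓝 (y.1 l)) := by
    have := AffineMap.lineMap_continuous (p := y.1 l) (q := z.1 l) |>.tendsto (0 : ℝ)
    rw [AffineMap.lineMap_apply_zero] at this
    exact this.mono_left nhdsWithin_le_nhds
  obtain ⟨η, hmin, hη⟩ := ((hline.eventually h).and
    (Ioo_mem_nhdsGT (zero_lt_one (α := ℝ)))).exists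
  set s := AffineMap.lineMap (y.1 l) (z.1 l) η
  have hs : |s| ≤ 1 / 2 := by
    rw [abs_le]
    exact (convex_Icc _ _).lineMap_mem (y.2 l) (z.2 l) ⟨hη.1.le, hη.2.le⟩
  have hcloser : |s - z.1 l| < |y.1 l - z.1 l| := by
    rw [← Real.dist_eq, dist_lineMap_right, Real.dist_eq, Real.norm_eq_abs,
      abs_of_pos (sub_pos.2 hη.2)]
    exact mul_lt_of_lt_one_left (abs_pos.2 (sub_ne_zero.2 (Ne.symm hne))) (by linarith [hη.1])
  refine hmin.not_gt ?_
  simp only [Cube.update_eq_self]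
  exact edist_proj_update_lt hv hd hs hcloser

theorem IsCoordMin.of_edist_add_edist (h : IsCoordMin y l v)
    (hv : edist (X.proj i z) v ≠ ∞)
    (hd : edist y z + edist (X.proj i z) v = edist (X.proj i y) v) : IsCoordMin z l v := by
  have heq := h.apply_eq_of_edist_add_edist hv hd
  rw [IsCoordMin, IsLocalMin, IsMinFilter, heq]
  filter_upwards [h] with s hs
  rw [← heq, Cube.update_eq_self]
  rw [Cube.update_eq_self] at hs
  refine ENNReal.le_of_add_le_add_left (edist_ne_top y z) ?_
  calc edist y z + edist (X.proj i z) v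
      = edist (X.proj i y) v := hd
    _ ≤ edist (X.proj i (y.update l s)) v := hs
    _ ≤ edist (X.proj i (y.update l s)) (X.proj i (z.update l s)) +
          edist (X.proj i (z.update l s)) v := edist_triangle ..
    _ ≤ edist y z + edist (X.proj i (z.update l s)) v := by
        gcongr
        refine (edist_proj_le ..).trans ?_
        rw [edist_dist, edist_dist]
        exact ENNReal.ofReal_le_ofReal (Cube.dist_update_le_dist y z l s)

theorem mem_openCarrier_of_mem_minCarrier {γ : ℝ → X.Point} (hγ : IsGeodesic γ P v)
    (hv : edist P v ≠ ∞) (hP : P ∈ minCarrier w v) : v ∈ openCarrier w := by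
  suffices v ∈ minCarrier w v by
    obtain ⟨i, x, hx, k, hk, hw, -⟩ := this
    exact ⟨i, x, hx, k, hk, hw⟩
  have hfin {t : ℝ} (ht : t ∈ Icc (0 : ℝ) 1) : edist (γ t) v ≠ ∞ := by
    rw [← hγ.2.1, hγ.2.2 t ht 1 (by simp)]
    finiteness
  have hadd {s t : ℝ} (hs : 0 ≤ s) (hst : s ≤ t) (ht : t ≤ 1) :
      edist (γ s) (γ t) + edist (γ t) v = edist (γ s) v := by
    simpa only [hγ.2.1] using hγ.edist_add_edist hs hst ht le_rfl
  suffices γ 1 ∈ minCarrier w v by rwa [hγ.2.1] at this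
  refine icc_induction (p := fun t => γ t ∈ minCarrier w v) zero_le_one (fun t ht => ?_)
    (hγ.1.symm ▸ hP)
  filter_upwards [(hγ.continuousOn hv t ht).eventually (eventually_exists_lift (γ t)),
    self_mem_nhdsWithin] with s hlift hs
  refine ⟨fun hst hmem => ?_, fun hts hmem => ?_⟩
  · obtain ⟨j, y, hy, l, hl, hw, hmin⟩ := hmem
    obtain ⟨z, hz, hzy⟩ := hlift j y hy
    have hd : edist y z + edist (X.proj j z) v = edist (X.proj j y) v := by
      rw [edist_comm y, hzy, hz, hy, edist_comm (γ t), hadd hs.1 hst ht.2]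
    have hzv : edist (X.proj j z) v ≠ ∞ := hz ▸ hfin ht
    refine ⟨j, z, hz, l, ?_, hw, hmin.of_edist_add_edist hzv hd⟩
    rwa [Cube.mem_freeCoords, hmin.apply_eq_of_edist_add_edist hzv hd, ← Cube.mem_freeCoords]
  · obtain ⟨j, y, hy⟩ := exists_proj_eq (γ s)
    obtain ⟨z, hz, hzy⟩ := hlift j y hy
    obtain ⟨l, hl, hw, hmin⟩ := exists_isCoordMin_of_mem_minCarrier hmem hz
    have hd : edist z y + edist (X.proj j y) v = edist (X.proj j z) v := by
      rw [hzy, hz, hy, hadd ht.1 hts hs.2]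
    have hyv : edist (X.proj j y) v ≠ ∞ := hy ▸ hfin hs
    refine ⟨j, y, hy, l, ?_, hw, hmin.of_edist_add_edist hyv hd⟩
    rwa [Cube.mem_freeCoords, hmin.apply_eq_of_edist_add_edist hyv hd, ← Cube.mem_freeCoords]

end Carriers

section Convexity

open Filter Topology Set

variable {X : CubeComplex.{u}} {i : X.Index} {x : Cube (X.dim i)} {k : Fin (X.dim i)}
  {v : X.Point} {σ : ℝ}

theorem isGeodesic_proj_update {s t : ℝ} (hs : |s| ≤ 1 / 2) (ht : |t| ≤ 1 / 2)
    (h : edist (x.update k s) (x.update k t) < (x.update k s).radius / 2) :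
    IsGeodesic (fun η => X.proj i (x.update k (AffineMap.lineMap s t (η : ℝ))))
      (X.proj i (x.update k s)) (X.proj i (x.update k t)) := by
  set γ := fun η : ℝ => X.proj i (x.update k (AffineMap.lineMap s t η))
  have hγ0 : γ 0 = X.proj i (x.update k s) := by simp only [γ, AffineMap.lineMap_apply_zero]
  have hγ1 : γ 1 = X.proj i (x.update k t) := by simp only [γ, AffineMap.lineMap_apply_one]
  have hγ01 : edist (γ 0) (γ 1) = edist s t := by
    rw [hγ0, hγ1, edist_proj_eq h, edist_dist, Cube.dist_update_update hs ht, edist_dist,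
      Real.dist_eq]
  have hline {η : ℝ} (hη : η ∈ Icc (0 : ℝ) 1) : |AffineMap.lineMap s t η| ≤ 1 / 2 :=
    abs_le.2 ((convex_Icc _ _).lineMap_mem (abs_le.1 hs) (abs_le.1 ht) hη)
  rw [← hγ0, ← hγ1]
  refine isGeodesic_of_edist_le (hγ01 ▸ edist_ne_top s t) fun η hη θ hθ => ?_
  refine (edist_proj_le i _ _).trans_eq ?_
  rw [hγ01, edist_dist, Cube.dist_update_update (hline hη) (hline hθ), ← Real.dist_eq,
    dist_lineMap_lineMap, ENNReal.ofReal_mul dist_nonneg, Real.dist_eq, edist_dist]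

theorem edist_update_sub_update_add (hsub : |x.1 k - σ| ≤ 1 / 2) (hadd : |x.1 k + σ| ≤ 1 / 2) :
    edist (x.update k (x.1 k - σ)) (x.update k (x.1 k + σ)) = 2 * ENNReal.ofReal |σ| := by
  rw [edist_dist, Cube.dist_update_update hsub hadd, abs_sub_comm, add_sub_sub_cancel, ← two_mul,
    abs_mul, abs_two, ENNReal.ofReal_mul two_pos.le, ENNReal.ofReal_ofNat]

theorem edist_update_sub_update_add_lt (hk : k ∈ x.freeCoords) (hsub : |x.1 k - σ| ≤ 1 / 2)
    (hadd : |x.1 k + σ| ≤ 1 / 2) (hσ : 5 * ENNReal.ofReal |σ| < x.radius) :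
    edist (x.update k (x.1 k - σ)) (x.update k (x.1 k + σ)) <
      (x.update k (x.1 k - σ)).radius / 2 := by
  set p := x.update k (x.1 k - σ) with hp
  have hxp : edist x p = ENNReal.ofReal |σ| := by
    rw [edist_comm, edist_dist, Cube.dist_update_self hsub, sub_sub_cancel_left, abs_neg]
  have hradius : x.radius ≤ p.radius + ENNReal.ofReal |σ| := by
    rw [← hxp]
    refine Cube.radius_le_add_edist ((Cube.freeCoords_update_subset x k _).trans ?_)
    rw [Finset.insert_eq_of_mem hk]
  rw [hp, edist_update_sub_update_add hsub hadd, ← hp,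
    ENNReal.lt_div_iff_mul_lt (by simp) (by simp)]
  refine lt_of_add_lt_add_right (a := ENNReal.ofReal |σ|) ?_
  calc 2 * ENNReal.ofReal |σ| * 2 + ENNReal.ofReal |σ|
      = 5 * ENNReal.ofReal |σ| := by ring
    _ < x.radius := hσ
    _ ≤ p.radius + ENNReal.ofReal |σ| := hradius

theorem two_mul_edist_proj_le (hX : IsCAT0 X.Point) (hk : k ∈ x.freeCoords)
    (hσ : 5 * ENNReal.ofReal |σ| < x.radius) (v : X.Point) :
    2 * edist (X.proj i x) v ≤ edist (X.proj i (x.update k (x.1 k - σ))) v +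
      edist (X.proj i (x.update k (x.1 k + σ))) v := by
  have hσk : |σ| < 1 / 2 - |x.1 k| := by
    have := (Cube.lt_radius_iff.1 hσ).1 k hk
    rw [← ENNReal.ofReal_ofNat 5, ← ENNReal.ofReal_mul (by norm_num),
      ENNReal.ofReal_lt_ofReal_iff'] at this
    linarith [this.1, abs_nonneg σ]
  have hsub : |x.1 k - σ| ≤ 1 / 2 := by linarith [abs_sub (x.1 k) σ]
  have hadd : |x.1 k + σ| ≤ 1 / 2 := by linarith [abs_add_le (x.1 k) σ]
  have := hX.two_mul_edist_le (isGeodesic_proj_update hsub hadd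
    (edist_update_sub_update_add_lt hk hsub hadd hσ)) v
  rwa [show AffineMap.lineMap (x.1 k - σ) (x.1 k + σ) (1 / 2 : ℝ) = x.1 k by
    rw [AffineMap.lineMap_apply_ring]; ring, Cube.update_eq_self] at this

theorem IsCoordMin.of_isLocalMax (hX : IsCAT0 X.Point) (hk : k ∈ x.freeCoords)
    (h : IsLocalMax (fun s => edist (X.proj i (x.update k s)) v) (x.1 k)) :
    IsCoordMin x k v := by
  have hsmall : ∀ᶠ s in 𝓝 (x.1 k), 5 * ENNReal.ofReal |s - x.1 k| < x.radius := by
    have hcont : Continuous fun s => 5 * ENNReal.ofReal |s - x.1 k| :=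
      (ENNReal.continuous_const_mul (by simp)).comp (ENNReal.continuous_ofReal.comp (by fun_prop))
    refine hcont.continuousAt.eventually_lt_const ?_
    simpa using x.radius_pos
  have hreflect : Tendsto (fun s => x.1 k - (s - x.1 k)) (𝓝 (x.1 k)) (𝓝 (x.1 k)) := by
    have : Continuous fun s => x.1 k - (s - x.1 k) := by fun_prop
    simpa using this.tendsto (x.1 k)
  filter_upwards [hsmall, hreflect.eventually h] with s hs hmax
  simp only [Cube.update_eq_self] at hmax ⊢
  have hmid := two_mul_edist_proj_le hX hk hs v
  rw [add_sub_cancel, two_mul] at hmid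
  exact ENNReal.le_of_add_le_add_left (hX.edist_ne_top _ _)
    (hmid.trans (add_le_add_left hmax _))

theorem mem_openCarrier_of_edist_eq (hX : IsCAT0 X.Point) {s t : ℝ} (hs : -(1 / 2) ≤ s)
    (hst : s < t) (ht : t ≤ 1 / 2) (h : edist (X.proj i (x.update k s)) v =
      edist (X.proj i (x.update k t)) v) : v ∈ openCarrier (hyperplane i k) := by
  have hcont : Continuous fun r => edist (X.proj i (x.update k r)) v :=
    ((continuous_proj i).comp ((Cube.continuous_update k).comp
      (Continuous.prodMk_right x))).edist continuous_const
  obtain ⟨r, hr, hext⟩ := exists_isLocalExtr_Ioo hst hcont.continuousOn h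
  have hr' : |r| < 1 / 2 := abs_lt.2 ⟨by linarith [hr.1], by linarith [hr.2]⟩
  have hkr : (x.update k r).1 k = r := Cube.update_apply_self_of_abs_le hr'.le x k
  have hk : k ∈ (x.update k r).freeCoords := by
    rw [Cube.mem_freeCoords, hkr]
    exact hr'.ne
  have hmin : IsCoordMin (x.update k r) k v := by
    rcases hext with hmin | hmax
    · simp only [IsCoordMin, Cube.update_update, hkr]
      exact hmin
    · refine .of_isLocalMax hX hk ?_
      simp only [Cube.update_update, hkr]
      exact hmax
  obtain ⟨γ, hγ⟩ := hX.exists_geodesic (X.proj i (x.update k r)) v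
  exact mem_openCarrier_of_mem_minCarrier hγ (hX.edist_ne_top _ _) ⟨i, _, rfl, k, hk, rfl, hmin⟩

end Convexity

section Sides

open Set

variable {X : CubeComplex.{u}} {i j : X.Index} {c : Cube (X.dim i)} {k : Fin (X.dim i)}
  {l : Fin (X.dim j)} {P Q v : X.Point}

/-- The points that are closer to the face of the `i`-th cube on which the `k`-th coordinate is
`-1/2` than to the opposite face. Away from the open carrier of the hyperplane dual to that
coordinate, this is one of the two sides of the hyperplane; the distances to the faces are measured
at the centres of the faces. -/
def negSide (i : X.Index) (k : Fin (X.dim i)) : Set X.Point :=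
  {v | edist (X.proj i ((Cube.ofFun 0).update k (-(1 / 2)))) v <
    edist (X.proj i ((Cube.ofFun 0).update k (1 / 2))) v}

theorem mem_negSide_iff (hX : IsCAT0 X.Point) (hv : v ∉ openCarrier (hyperplane i k))
    (x : Cube (X.dim i)) {s t : ℝ} (hs : -(1 / 2) ≤ s) (hst : s < t) (ht : t ≤ 1 / 2) :
    v ∈ negSide i k ↔
      edist (X.proj i (x.update k s)) v < edist (X.proj i (x.update k t)) v := by
  have hcont {f : Cube (X.dim i) × ℝ × ℝ → ℝ} (hf : Continuous f) :
      Continuous fun p : Cube (X.dim i) × ℝ × ℝ => edist (X.proj i (p.1.update k (f p))) v :=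
    ((continuous_proj i).comp ((Cube.continuous_update k).comp
      (continuous_fst.prodMk hf))).edist continuous_const
  have hconvex : Convex ℝ {p : ℝ × ℝ | -(1 / 2) ≤ p.1 ∧ p.1 < p.2 ∧ p.2 ≤ 1 / 2} := by
    have hlt : Convex ℝ {p : ℝ × ℝ | p.1 < p.2} := by
      simpa only [LinearMap.sub_apply, LinearMap.fst_apply, LinearMap.snd_apply, sub_neg] using
        convex_halfSpace_lt (LinearMap.fst ℝ ℝ ℝ - LinearMap.snd ℝ ℝ ℝ).isLinear 0
    exact (convex_halfSpace_ge (LinearMap.fst ℝ ℝ ℝ).isLinear _).inter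
      (hlt.inter (convex_halfSpace_le (LinearMap.snd ℝ ℝ ℝ).isLinear _))
  exact lt_iff_lt_of_isPreconnected (isPreconnected_univ.prod hconvex.isPreconnected)
    (x := (Cube.ofFun 0, -(1 / 2), 1 / 2)) (y := (x, s, t))
    (hcont continuous_snd.fst).continuousOn (hcont continuous_snd.snd).continuousOn
    (fun p hp h => hv (mem_openCarrier_of_edist_eq hX hp.2.1 hp.2.2.1 hp.2.2.2 h))
    ⟨mem_univ _, by norm_num⟩ ⟨mem_univ _, hs, hst, ht⟩

theorem notMem_negSide_iff (hX : IsCAT0 X.Point) (hv : v ∉ openCarrier (hyperplane i k))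
    (x : Cube (X.dim i)) {s t : ℝ} (hs : -(1 / 2) ≤ s) (hst : s < t) (ht : t ≤ 1 / 2) :
    v ∉ negSide i k ↔
      edist (X.proj i (x.update k t)) v < edist (X.proj i (x.update k s)) v := by
  rw [mem_negSide_iff hX hv x hs hst ht, not_lt, le_iff_lt_or_eq, or_iff_left]
  exact fun h => hv (mem_openCarrier_of_edist_eq hX hs hst ht h.symm)

theorem mem_negSide_iff_of_isPreconnected (hX : IsCAT0 X.Point) {S : Set X.Point}
    (hS : IsPreconnected S) (hdisj : Disjoint S (openCarrier (hyperplane i k))) (hP : P ∈ S)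
    (hQ : Q ∈ S) : P ∈ negSide i k ↔ Q ∈ negSide i k :=
  lt_iff_lt_of_isPreconnected hS (continuous_const.edist continuous_id).continuousOn
    (continuous_const.edist continuous_id).continuousOn
    (fun _ hv h => hdisj.notMem_of_mem_left hv
      (mem_openCarrier_of_edist_eq hX le_rfl (by norm_num) le_rfl h)) hP hQ

theorem mem_negSide_iff_mem_negSide_congr (hX : IsCAT0 X.Point)
    (h : hyperplane i k = hyperplane j l) (hP : P ∉ openCarrier (hyperplane i k))
    (hQ : Q ∉ openCarrier (hyperplane i k)) :
    (P ∈ negSide i k ↔ Q ∈ negSide i k) ↔ (P ∈ negSide j l ↔ Q ∈ negSide j l) := by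
  let SameSide (e : Σ i : X.Index, Fin (X.dim i)) : Prop :=
    P ∉ openCarrier (hyperplane e.1 e.2) → Q ∉ openCarrier (hyperplane e.1 e.2) →
      (P ∈ negSide e.1 e.2 ↔ Q ∈ negSide e.1 e.2)
  have hcongr (e e' : Σ i : X.Index, Fin (X.dim i)) (he : X.SharesSegment e e') :
      SameSide e = SameSide e' := by
    have hw : hyperplane e.1 e.2 = hyperplane e'.1 e'.2 := Quot.sound he
    obtain ⟨x, y, τ, hτ, hxy⟩ := he
    simp only [SameSide, ← hw]
    refine propext (forall₂_congr fun hP hQ => ?_)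
    have hside {v : X.Point} (hv : v ∉ openCarrier (hyperplane e.1 e.2)) :
        v ∈ negSide e.1 e.2 ↔ edist (X.proj e'.1 (y.update e'.2 (τ * -(1 / 2)))) v <
          edist (X.proj e'.1 (y.update e'.2 (τ * (1 / 2)))) v := by
      rw [mem_negSide_iff hX hv x le_rfl (by norm_num) le_rfl, hxy, hxy]
    rw [hside hP, hside hQ]
    rw [hw] at hP hQ
    rcases eq_or_eq_neg_of_abs_eq hτ with rfl | rfl
    · rw [mem_negSide_iff hX hP y le_rfl (by norm_num) le_rfl,
        mem_negSide_iff hX hQ y le_rfl (by norm_num) le_rfl, one_mul, one_mul]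
    · rw [← not_iff_not (a := P ∈ negSide _ _),
        notMem_negSide_iff hX hP y le_rfl (by norm_num) le_rfl,
        notMem_negSide_iff hX hQ y le_rfl (by norm_num) le_rfl, neg_one_mul, neg_one_mul, neg_neg]
  have hiff : SameSide ⟨i, k⟩ ↔ SameSide ⟨j, l⟩ := (congrArg (Quot.lift SameSide hcongr) h).to_iff
  simpa only [SameSide, ← h, hP, hQ, not_false_eq_true, forall_const] using hiff

theorem notMem_openCarrier_of_freeCoords_eq_empty (hc : c.freeCoords = ∅) (w : X.Hyperplane) :
    X.proj i c ∉ openCarrier w := fun h => by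
  obtain ⟨k, hk, -⟩ := exists_hyperplane_eq_of_mem_openCarrier h rfl
  exact Finset.notMem_empty k (hc ▸ hk)

theorem proj_mem_negSide_iff (hX : IsCAT0 X.Point) (hc : c.freeCoords = ∅) (k : Fin (X.dim i)) :
    X.proj i c ∈ negSide i k ↔ c.1 k = -(1 / 2) := by
  have hv := notMem_openCarrier_of_freeCoords_eq_empty hc (hyperplane i k)
  have hself := c.update_eq_self k
  rcases Cube.apply_eq_or_of_freeCoords_eq_empty hc k with hck | hck <;> rw [hck] at hself ⊢
  · rw [mem_negSide_iff hX hv c le_rfl (by norm_num) le_rfl, hself, edist_self]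
    norm_num
  · rw [← not_iff_not, notMem_negSide_iff hX hv c le_rfl (by norm_num) le_rfl, hself, edist_self]
    simp

theorem proj_mem_negSide_iff_proj_flip_mem_negSide (hX : IsCAT0 X.Point) (hc : c.freeCoords = ∅)
    (k : Fin (X.dim i)) (l : Fin (X.dim j)) :
    (X.proj i c ∈ negSide j l ↔ X.proj i (c.flip k) ∈ negSide j l) ↔
      hyperplane i k ≠ hyperplane j l := by
  have hflip := Cube.freeCoords_flip hc k
  refine ⟨fun h heq => ?_, fun hne => ?_⟩
  · rw [← mem_negSide_iff_mem_negSide_congr hX heq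
      (notMem_openCarrier_of_freeCoords_eq_empty hc _)
      (notMem_openCarrier_of_freeCoords_eq_empty hflip _), proj_mem_negSide_iff hX hc,
      proj_mem_negSide_iff hX hflip, Cube.flip_apply_self] at h
    rcases Cube.apply_eq_or_of_freeCoords_eq_empty hc k with hck | hck <;>
      norm_num [hck] at h
  · have hcont : Continuous fun s => X.proj i (c.update k s) :=
      (continuous_proj i).comp ((Cube.continuous_update k).comp (Continuous.prodMk_right c))
    refine mem_negSide_iff_of_isPreconnected hX (isPreconnected_range hcont) ?_
      ⟨c.1 k, congrArg (X.proj i) (c.update_eq_self k)⟩ ⟨-c.1 k, rfl⟩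
    refine disjoint_left.2 fun v ⟨s, hs⟩ hv => ?_
    obtain ⟨m, hm, heq⟩ := exists_hyperplane_eq_of_mem_openCarrier hv hs
    have := c.freeCoords_update_subset k s hm
    rw [hc, insert_empty_eq, Finset.mem_singleton] at this
    exact hne (this ▸ heq)

theorem freeCoords_eq_empty_of_proj_eq {c' : Cube (X.dim j)} (hc : c.freeCoords = ∅)
    (h : X.proj j c' = X.proj i c) : c'.freeCoords = ∅ :=
  Finset.eq_empty_of_forall_notMem fun _ hk => by
    obtain ⟨l, hl, -⟩ := exists_proj_update_eq h hk
    exact Finset.notMem_empty l (hc ▸ hl)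

theorem exists_edist_proj_update_lt (hX : IsCAT0 X.Point) (hne : P ≠ Q) :
    ∃ (i : X.Index) (x : Cube (X.dim i)) (k : Fin (X.dim i)), X.proj i x = P ∧
      ∃ s : ℝ, |s| ≤ 1 / 2 ∧ edist (X.proj i (x.update k s)) Q < edist P Q := by
  obtain ⟨γ, hγ⟩ := hX.exists_geodesic P Q
  obtain ⟨t, hlift, ht⟩ : ∃ t, (∀ (i : X.Index) (y : Cube (X.dim i)), X.proj i y = γ t →
      ∃ z, X.proj i z = γ 0 ∧ edist z y = edist (γ 0) (γ t)) ∧ t ∈ Ioc (0 : ℝ) 1 := by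
    have hcont := hγ.continuousOn (hX.edist_ne_top _ _) 0 (left_mem_Icc.2 zero_le_one)
    have := (hcont.mono Ioc_subset_Icc_self).eventually (eventually_exists_lift (γ 0))
    rw [nhdsWithin_Ioc_eq_nhdsGT one_pos] at this
    exact (this.and (Ioc_mem_nhdsGT one_pos)).exists
  obtain ⟨i, z, hz⟩ := exists_proj_eq (γ t)
  obtain ⟨x, hx, hxz⟩ := hlift i z hz
  have hd : edist x z + edist (X.proj i z) Q = edist (X.proj i x) Q := by
    have := hγ.edist_add_edist le_rfl ht.1.le ht.2 le_rfl
    rwa [hγ.2.1, ← hxz, ← hz, ← hx] at this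
  obtain ⟨k, hk⟩ : ∃ k, x.1 k ≠ z.1 k := by
    by_contra! h
    rw [Cube.ext_apply h, edist_self, hγ.2.2 0 (by simp) t ⟨ht.1.le, ht.2⟩, zero_sub, abs_neg,
      abs_of_pos ht.1, zero_eq_mul, ENNReal.ofReal_eq_zero] at hxz
    exact hxz.elim ht.1.not_ge fun h => hne (hX.eq_of_edist_eq_zero _ _ h)
  obtain rfl : X.proj i x = P := hx.trans hγ.1
  refine ⟨i, x, k, rfl, z.1 k, z.abs_apply_le k, ?_⟩
  refine edist_proj_update_lt (hX.edist_ne_top _ _) hd (z.abs_apply_le k) ?_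
  rw [sub_self, abs_zero]
  exact abs_pos.2 (sub_ne_zero.2 hk)

theorem exists_corner_not_mem_negSide_iff (hX : IsCAT0 X.Point) (hc : c.freeCoords = ∅)
    (hQ : ∀ w, Q ∉ openCarrier w) (hne : X.proj i c ≠ Q) :
    ∃ (j : X.Index) (c' : Cube (X.dim j)) (k : Fin (X.dim j)), c'.freeCoords = ∅ ∧
      X.proj j c' = X.proj i c ∧ ¬(X.proj j c' ∈ negSide j k ↔ Q ∈ negSide j k) := by
  obtain ⟨j, c', k, hc', s, hs, hcloser⟩ := exists_edist_proj_update_lt hX hne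
  have hcorner := freeCoords_eq_empty_of_proj_eq hc hc'
  refine ⟨j, c', k, hcorner, hc', ?_⟩
  rw [proj_mem_negSide_iff hX hcorner]
  rw [← hc', ← c'.update_eq_self k, Cube.update_update] at hcloser
  have hne : s ≠ c'.1 k := fun h => hcloser.ne (h ▸ rfl)
  rw [abs_le] at hs
  rcases Cube.apply_eq_or_of_freeCoords_eq_empty hcorner k with hck | hck <;>
    rw [hck] at hne hcloser ⊢
  · have hQk := (mem_negSide_iff hX (hQ _) c' hs.1 (hs.2.lt_of_ne hne) le_rfl).2 hcloser
    rw [iff_true_right hQk]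
    norm_num
  · have hQk := (notMem_negSide_iff hX (hQ _) c' le_rfl (hs.1.lt_of_ne' hne) hs.2).2 hcloser
    rw [iff_false_right hQk]
    norm_num

end Sides

section EdgePaths

open Set
open scoped symmDiff

variable {X : CubeComplex.{u}} {i : X.Index} {c c' : Cube (X.dim i)} {x y : X.Vertex}

theorem isCell_zero_singleton (hc : c.freeCoords = ∅) : X.IsCell 0 {X.proj i c} := by
  refine ⟨i, c, Finset.card_eq_zero.2 hc, ?_⟩
  have hsupport : c.support = {c} :=
    Set.eq_singleton_iff_unique_mem.2 ⟨c.mem_support_self, fun z hz =>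
      Cube.ext_apply fun l => hz l (hc ▸ Finset.notMem_empty l)⟩
  rw [hsupport, image_singleton]

/-- The vertex of the complex that a corner of a cube represents. -/
def vertexOf (i : X.Index) (c : Cube (X.dim i)) (hc : c.freeCoords = ∅) : X.Vertex :=
  ⟨X.proj i c, isCell_zero_singleton hc⟩

theorem exists_vertexOf_eq (x : X.Vertex) :
    ∃ (i : X.Index) (c : Cube (X.dim i)) (hc : c.freeCoords = ∅), vertexOf i c hc = x := by
  obtain ⟨x, i, c, hc, hS⟩ := x
  have hx : X.proj i c ∈ ({x} : Set X.Point) := hS ▸ mem_image_of_mem _ c.mem_support_self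
  exact ⟨i, c, Finset.card_eq_zero.1 hc, Subtype.ext hx⟩

theorem freeCoords_eq_empty_of_proj_eq_vertex (h : X.proj i c = x.1) : c.freeCoords = ∅ := by
  obtain ⟨j, c₀, hc₀, rfl⟩ := exists_vertexOf_eq x
  exact freeCoords_eq_empty_of_proj_eq hc₀ h

theorem adj_vertexOf_flip (hc : c.freeCoords = ∅) (k : Fin (X.dim i))
    (hne : vertexOf i c hc ≠ vertexOf i (c.flip k) (Cube.freeCoords_flip hc k)) :
    X.oneSkeleton.Adj (vertexOf i c hc) (vertexOf i (c.flip k) (Cube.freeCoords_flip hc k)) := by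
  have hk : (c.update k 0).freeCoords = {k} := by
    refine Finset.Subset.antisymm ((c.freeCoords_update_subset k 0).trans_eq ?_) ?_
    · rw [hc, insert_empty_eq]
    · rw [Finset.singleton_subset_iff, Cube.mem_freeCoords,
        Cube.update_apply_self_of_abs_le (by norm_num)]
      norm_num
  have ne_of_notMem {l : Fin (X.dim i)} (hl : l ∉ (c.update k 0).freeCoords) : l ≠ k := by
    rwa [hk, Finset.mem_singleton] at hl
  refine ⟨hne, X.proj i '' (c.update k 0).support,
    ⟨i, _, by rw [hk, Finset.card_singleton], rfl⟩, ⟨c, fun l hl => ?_, rfl⟩,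
    ⟨c.flip k, fun l hl => ?_, rfl⟩⟩
  · rw [Cube.update_apply_of_ne (ne_of_notMem hl)]
  · rw [Cube.update_apply_of_ne (ne_of_notMem hl), Cube.flip_apply_of_ne (ne_of_notMem hl)]

theorem exists_flip_of_adj (h : X.oneSkeleton.Adj x y) :
    ∃ (i : X.Index) (c : Cube (X.dim i)) (hc : c.freeCoords = ∅) (k : Fin (X.dim i)),
      vertexOf i c hc = x ∧ vertexOf i (c.flip k) (Cube.freeCoords_flip hc k) = y := by
  obtain ⟨hne, e, ⟨i, a, ha, rfl⟩, ⟨c, hc, hcx⟩, ⟨c', hc', hcy⟩⟩ := h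
  obtain ⟨k, hk⟩ := Finset.card_eq_one.1 ha
  have hcc' : c ≠ c' := fun h => hne (Subtype.ext (by rw [← hcx, ← hcy, h]))
  have hcorner := freeCoords_eq_empty_of_proj_eq_vertex hcx
  have hflip : c.flip k = c' := by
    refine Cube.flip_eq_of_forall_ne hcorner (freeCoords_eq_empty_of_proj_eq_vertex hcy) hcc'
      fun l hl => ?_
    have hla : l ∉ a.freeCoords := by rwa [hk, Finset.mem_singleton]
    rw [hc l hla, hc' l hla]
  exact ⟨i, c, hcorner, k, Subtype.ext hcx, Subtype.ext (hflip ▸ hcy)⟩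

theorem exists_walk_length_le_distOne (hc : c.freeCoords = ∅) (hc' : c'.freeCoords = ∅) :
    ∃ p : X.oneSkeleton.Walk (vertexOf i c hc) (vertexOf i c' hc'),
      (p.length : ℝ) ≤ c.distOne c' := by
  suffices ∀ S : Finset (Fin (X.dim i)), (∀ l ∉ S, c.1 l = c'.1 l) →
      ∃ p : X.oneSkeleton.Walk (vertexOf i c hc) (vertexOf i c' hc'),
        (p.length : ℝ) ≤ c.distOne c' from
    this Finset.univ fun l hl => absurd (Finset.mem_univ l) hl
  intro S hS
  induction S using Finset.induction_on generalizing c with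
  | empty =>
    obtain rfl : c = c' := Cube.ext_apply fun l => hS l (Finset.notMem_empty l)
    exact ⟨.nil, by simp [Cube.distOne]⟩
  | insert k S _ ih =>
    by_cases hk : c.1 k = c'.1 k
    · refine ih hc fun l hl => ?_
      rcases eq_or_ne l k with rfl | hlk
      exacts [hk, hS l (by simp [hl, hlk])]
    have hflip := Cube.freeCoords_flip hc k
    have hkk : (c.flip k).1 k = c'.1 k := by
      rw [Cube.flip_apply_self, Cube.neg_apply_eq_of_ne hc hc' hk]
    obtain ⟨p, hp⟩ := ih hflip fun l hl => by
      rcases eq_or_ne l k with rfl | hlk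
      · exact hkk
      · rw [Cube.flip_apply_of_ne hlk, hS l (by simp [hl, hlk])]
    have hdist : c.distOne c' = (c.flip k).distOne c' + 1 := by
      rw [← Cube.distOne_flip hc k, add_comm, Cube.distOne_add_distOne fun l => ?_]
      rcases eq_or_ne l k with rfl | hlk
      exacts [.inr hkk, .inl (Cube.flip_apply_of_ne hlk c)]
    by_cases heq : vertexOf i c hc = vertexOf i (c.flip k) hflip
    · refine ⟨p.copy heq.symm rfl, ?_⟩
      rw [SimpleGraph.Walk.length_copy]
      linarith
    · refine ⟨.cons (adj_vertexOf_flip hc k heq) p, ?_⟩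
      rw [SimpleGraph.Walk.length_cons, Nat.cast_succ]
      linarith

theorem exists_walk_of_string {P : X.Point} {ℓ : ℝ≥0} (h : X.HasString P y.1 ℓ)
    {z : Cube (X.dim i)} (hz : X.proj i z = P) :
    ∃ (c : Cube (X.dim i)) (hc : c.freeCoords = ∅) (p : X.oneSkeleton.Walk (vertexOf i c hc) y),
      ∀ K : ℝ, (∀ j, √(X.dim j) ≤ K) → p.length + z.distOne c ≤ K * ℓ := by
  generalize hQ : y.1 = Q at h
  induction h generalizing i z with
  | nil P =>
    have hyz : X.proj i z = y.1 := hz.trans hQ.symm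
    have hz₀ := freeCoords_eq_empty_of_proj_eq_vertex hyz
    have hvertex : vertexOf i z hz₀ = y := Subtype.ext hyz
    exact ⟨z, hz₀, SimpleGraph.Walk.nil.copy rfl hvertex, fun K _ => by simp [Cube.distOne]⟩
  | cons j a b Q ℓ _ ih =>
    obtain ⟨c, hc, p, hp⟩ := ih rfl hQ
    obtain ⟨e, he, hae⟩ := Cube.exists_corner_between a hc
    obtain ⟨q, hq⟩ := exists_walk_length_le_distOne he hc
    obtain ⟨h, hha, hproj⟩ := exists_isometry_of_proj_eq hz.symm
    have hhe := freeCoords_eq_empty_of_proj_eq he (hproj e).symm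
    have hvertex : vertexOf j e.1 he = vertexOf i (h e).1 hhe := Subtype.ext (hproj e)
    refine ⟨(h e).1, hhe, (q.append p).copy hvertex rfl, fun K hK => ?_⟩
    have hze : z.distOne (h e).1 = a.distOne e.1 := by
      rw [← Cube.distOne_map h ⟨a, a.mem_support_self⟩ e, hha]
    rw [SimpleGraph.Walk.length_copy, SimpleGraph.Walk.length_append, Nat.cast_add, hze]
    calc (q.length : ℝ) + p.length + a.distOne e.1
        ≤ a.distOne c + p.length := by linarith
      _ ≤ a.distOne b + (p.length + b.distOne c) := by linarith [a.distOne_triangle b c]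
      _ ≤ K * dist a b + K * ℓ := by
        gcongr
        exacts [(a.distOne_le b).trans (by gcongr; exact hK j), hp K hK]
      _ = K * (nndist a b + ℓ : ℝ≥0) := by rw [NNReal.coe_add, coe_nndist, mul_add]

theorem exists_walk_of_string_vertex {ℓ : ℝ≥0} (h : X.HasString x.1 y.1 ℓ) :
    ∃ p : X.oneSkeleton.Walk x y, ∀ K : ℝ, (∀ j, √(X.dim j) ≤ K) → p.length ≤ K * ℓ := by
  obtain ⟨i, c, hc, rfl⟩ := exists_vertexOf_eq x
  obtain ⟨c', hc', p, hp⟩ := exists_walk_of_string h rfl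
  obtain ⟨q, hq⟩ := exists_walk_length_le_distOne hc hc'
  refine ⟨q.append p, fun K hK => ?_⟩
  rw [SimpleGraph.Walk.length_append, Nat.cast_add]
  linarith [hp K hK]

theorem oneSkeleton_preconnected (hX : ∀ P Q : X.Point, edist P Q ≠ ∞) :
    X.oneSkeleton.Preconnected := fun x y => by
  obtain ⟨ℓ, hℓ⟩ := iInf_lt_iff.1 (hX x.1 y.1).lt_top
  obtain ⟨h, -⟩ := iInf_lt_iff.1 hℓ
  exact ⟨(exists_walk_of_string_vertex h).choose⟩

theorem D_le_sqrt_mul_d (hX : ∀ P Q : X.Point, edist P Q ≠ ∞) {n : ℕ} (hn : X.dimension ≤ n)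
    (x y : X.Vertex) : X.D x y ≤ √n * X.d x.1 y.1 := by
  have hK (j : X.Index) : √(X.dim j) ≤ √n := by
    have : X.dim j ≤ n := ENat.natCast_le_natCast.1 ((le_iSup (fun j => (X.dim j : ℕ∞)) j).trans hn)
    gcongr
  have hedist : ENNReal.ofReal (X.D x y) / ENNReal.ofReal √n ≤ edist x.1 y.1 := by
    refine le_iInf₂ fun ℓ h => ENNReal.div_le_of_le_mul' ?_
    obtain ⟨p, hp⟩ := exists_walk_of_string_vertex h
    rw [← ENNReal.ofReal_coe_nnreal, ← ENNReal.ofReal_mul (Real.sqrt_nonneg _)]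
    exact ENNReal.ofReal_le_ofReal
      ((Nat.cast_le.2 (SimpleGraph.dist_le p)).trans (hp _ hK))
  rw [ENNReal.div_le_iff_le_mul (.inr (hX _ _)) (.inl ENNReal.ofReal_ne_top)] at hedist
  rw [d, mul_comm, ← ENNReal.toReal_ofReal (Real.sqrt_nonneg n), ← ENNReal.toReal_mul]
  exact (ENNReal.ofReal_le_iff_le_toReal (ENNReal.mul_ne_top (hX _ _) ENNReal.ofReal_ne_top)).1
    hedist

theorem edist_le_length (p : X.oneSkeleton.Walk x y) : edist x.1 y.1 ≤ p.length := by
  induction p with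
  | nil => simp
  | @cons x y z h p ih =>
    have hxy : edist x.1 y.1 ≤ 1 := by
      obtain ⟨i, c, hc, k, rfl, rfl⟩ := exists_flip_of_adj h
      refine (edist_proj_le i _ _).trans ?_
      rw [edist_dist, Cube.dist_flip hc, ENNReal.ofReal_one]
    rw [SimpleGraph.Walk.length_cons, Nat.cast_succ, add_comm]
    exact (edist_triangle _ _ _).trans (add_le_add hxy ih)

theorem d_le_D (h : X.oneSkeleton.Reachable x y) : X.d x.1 y.1 ≤ X.D x y := by
  obtain ⟨p, hp⟩ := h.exists_walk_length_eq_dist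
  rw [D, ← hp, d, ← ENNReal.toReal_natCast]
  exact ENNReal.toReal_mono (ENNReal.natCast_ne_top _) (edist_le_length p)

theorem IsCellularAction.adj_vertexMap {G : Type v} [Group G] [MulAction G X.Point]
    (hG : X.IsCellularAction G) (g : G) (h : X.oneSkeleton.Adj x y) :
    X.oneSkeleton.Adj (hG.vertexMap g x) (hG.vertexMap g y) := by
  obtain ⟨hne, e, he, hx, hy⟩ := h
  exact ⟨fun h => hne (Subtype.ext (smul_left_cancel g (congrArg Subtype.val h))), _,
    hG g 1 e he, mem_image_of_mem _ hx, mem_image_of_mem _ hy⟩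

theorem IsCellularAction.vertexMap_inv_vertexMap {G : Type v} [Group G] [MulAction G X.Point]
    (hG : X.IsCellularAction G) (g : G) (x : X.Vertex) :
    hG.vertexMap g⁻¹ (hG.vertexMap g x) = x :=
  Subtype.ext (inv_smul_smul g x.1)

/-- The automorphism of the `1`-skeleton that `g` induces. -/
def IsCellularAction.oneSkeletonIso {G : Type v} [Group G] [MulAction G X.Point]
    (hG : X.IsCellularAction G) (g : G) : X.oneSkeleton ≃g X.oneSkeleton where
  toFun := hG.vertexMap g
  invFun := hG.vertexMap g⁻¹
  left_inv := hG.vertexMap_inv_vertexMap g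
  right_inv x := Subtype.ext (smul_inv_smul g x.1)
  map_rel_iff' {x y} := by
    refine ⟨fun h => ?_, hG.adj_vertexMap g⟩
    rw [← hG.vertexMap_inv_vertexMap g x, ← hG.vertexMap_inv_vertexMap g y]
    exact hG.adj_vertexMap g⁻¹ h

theorem IsCellularAction.D_vertexMap {G : Type v} [Group G] [MulAction G X.Point]
    (hG : X.IsCellularAction G) (g : G) (x y : X.Vertex) :
    X.D (hG.vertexMap g x) (hG.vertexMap g y) = X.D x y :=
  congrArg Nat.cast (dist_map_iso (hG.oneSkeletonIso g) x y)

/-- The hyperplanes on whose negative side the vertex `x` lies. Which side of a hyperplane is the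
negative one depends on the choice of a coordinate direction dual to it. -/
def negSides (x : X.Vertex) : Set X.Hyperplane :=
  {w | x.1 ∈ negSide (Quot.out w).1 (Quot.out w).2}

theorem notMem_openCarrier_vertex (x : X.Vertex) (w : X.Hyperplane) : x.1 ∉ openCarrier w := by
  obtain ⟨i, c, hc, rfl⟩ := exists_vertexOf_eq x
  exact notMem_openCarrier_of_freeCoords_eq_empty hc w

theorem hyperplane_mem_symmDiff_negSides (hX : IsCAT0 X.Point) (k : Fin (X.dim i))
    (x y : X.Vertex) : hyperplane i k ∈ negSides x ∆ negSides y ↔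
      ¬(x.1 ∈ negSide i k ↔ y.1 ∈ negSide i k) := by
  rw [mem_negSide_iff_mem_negSide_congr hX (Quot.out_eq (hyperplane i k)).symm
    (notMem_openCarrier_vertex x _) (notMem_openCarrier_vertex y _), mem_symmDiff, negSides,
    negSides, mem_ofPred_eq, mem_ofPred_eq]
  tauto

theorem symmDiff_negSides_flip (hX : IsCAT0 X.Point) (hc : c.freeCoords = ∅)
    (k : Fin (X.dim i)) : negSides (vertexOf i c hc) ∆
      negSides (vertexOf i (c.flip k) (Cube.freeCoords_flip hc k)) = {hyperplane i k} := by
  ext w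
  obtain ⟨⟨j, l⟩, rfl⟩ := Quot.exists_rep w
  exact (hyperplane_mem_symmDiff_negSides hX l _ _).trans <|
    (not_congr (proj_mem_negSide_iff_proj_flip_mem_negSide hX hc k l)).trans <|
    not_not.trans eq_comm

theorem exists_adj_symmDiff_negSides_subset (hX : IsCAT0 X.Point) (hxy : x ≠ y) :
    ∃ x', X.oneSkeleton.Adj x x' ∧ negSides x ∆ negSides x' ⊆ negSides x ∆ negSides y := by
  obtain ⟨i₀, c₀, hc₀, hx⟩ := exists_vertexOf_eq x
  obtain ⟨i, c, k, hc, heq, hsep⟩ := exists_corner_not_mem_negSide_iff hX hc₀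
    (notMem_openCarrier_vertex y) fun h => hxy (hx.symm.trans (Subtype.ext h))
  obtain rfl : vertexOf i c hc = x := (Subtype.ext heq).trans hx
  have hflip := symmDiff_negSides_flip hX hc k
  refine ⟨_, adj_vertexOf_flip hc k fun h => ?_, ?_⟩
  · rw [← h, symmDiff_self] at hflip
    exact (singleton_ne_empty _).symm hflip
  · rw [hflip, singleton_subset_iff, hyperplane_mem_symmDiff_negSides hX]
    exact hsep

theorem exists_symmDiff_negSides_eq_singleton (hX : IsCAT0 X.Point)
    (h : X.oneSkeleton.Adj x y) : ∃ w, negSides x ∆ negSides y = {w} := by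
  obtain ⟨i, c, hc, k, rfl, rfl⟩ := exists_flip_of_adj h
  exact ⟨_, symmDiff_negSides_flip hX hc k⟩

theorem isConditionallyNegativeKernel_D (hX : IsCAT0 X.Point) :
    IsConditionallyNegativeKernel X.D := by
  have hadj (x y : X.Vertex) (h : X.oneSkeleton.Adj x y) :=
    exists_symmDiff_negSides_eq_singleton hX h
  have hconn := oneSkeleton_preconnected hX.edist_ne_top
  have hD : X.D = fun x y => ((negSides x ∆ negSides y).ncard : ℝ) := by
    funext x y
    rw [D, dist_eq_ncard_symmDiff hconn hadj fun _ _ => exists_adj_symmDiff_negSides_subset hX]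
  rw [hD]
  refine isConditionallyNegativeKernel_ncard_symmDiff negSides fun x y => ?_
  obtain ⟨p⟩ := hconn x y
  exact (finite_symmDiff_and_ncard_le_length_of_walk hadj p).1

end EdgePaths

end CubeComplex

theorem mainTheorem2 (X : CubeComplex.{u}) (hX : IsCAT0 X.Point) :
    X.oneSkeleton.Preconnected ∧
    IsConditionallyNegativeKernel X.D ∧
    (∀ (G : Type v) [Group G] [MulAction G X.Point] (hG : X.IsCellularAction G)
      (g : G) (x y : X.Vertex), X.D (hG.vertexMap g x) (hG.vertexMap g y) = X.D x y) ∧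
    (∀ x y : X.Vertex, X.d x.1 y.1 ≤ X.D x y) ∧
    (∀ n : ℕ, X.dimension = n → ∀ x y : X.Vertex, X.D x y ≤ √(n : ℝ) * X.d x.1 y.1) := by
  have hconn := CubeComplex.oneSkeleton_preconnected hX.edist_ne_top
  exact ⟨hconn, CubeComplex.isConditionallyNegativeKernel_D hX,
    fun _ _ _ hG g x y => hG.D_vertexMap g x y, fun x y => CubeComplex.d_le_D (hconn x y),
    fun _ hn => CubeComplex.D_le_sqrt_mul_d hX.edist_ne_top hn.le⟩
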